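/- **Setting.** Consider $N$ clocks, of which the first $N-M>0$ are cesium-type and the last $M>0$ are hydrogen-maser-type (Hm), with sampling interval $\tau>0$. Let $A=\begin{pmatrix}1&\tau\\0&1\end{pmatrix}$, $\beta=\begin{pmatrix}\tau^2/2\\ \tau\end{pmatrix}$, $B=\begin{pmatrix}\tau\\1\end{pmatrix}$, $C=(1\;\;0)$, $J=\begin{pmatrix}0\\I_M\end{pmatrix}\in\mathbb R^{N\times M}$. The phases $p[k]\in\mathbb R^N$, frequencies $f[k]\in\mathbb R^N$ (with $x=(p,f)$) and frequency drifts $z[k]\in\mathbb R^M$ of the Hm clocks satisfy $$x[k+1]=(A\otimes I_N)x[k]+(\beta\otimes J)z[k]+(B\otimes I_N)u[k]+v^x[k],\qquad z[k+1]=z[k]+v^z[k],$$ $$y[k]=(C\otimes V)x[k]+w[k],$$ where $V\in\mathbb R^{(N-1)\times N}$ has $\ker V=\operatorname{im}\mathbf 1_N$, $w$ is zero-mean white Gaussian noise with covariance $rI_{N-1}$, $r>0$, and $v=(v^x,v^z)$ is zero-mean white Gaussian noise with covariance $$Q=\begin{pmatrix}\tau\Sigma_1+\frac{\tau^3}{3}\Sigma_2+\frac{\tau^5}{20}\Sigma_3&\frac{\tau^2}{2}\Sigma_2+\frac{\tau^4}{8}\Sigma_3&\frac{\tau^3}{6}\Sigma_4\\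 \frac{\tau^2}{2}\Sigma_2+\frac{\tau^4}{8}\Sigma_3&\tau\Sigma_2+\frac{\tau^3}{3}\Sigma_3&\frac{\tau^2}{2}\Sigma_4\\ \frac{\tau^3}{6}\Sigma_4^\top&\frac{\tau^2}{2}\Sigma_4^\top&\tau\Sigma_5\end{pmatrix},$$ with $\Sigma_1=\operatorname{diag}(\sigma_{1i}^2)_{i\le N}$, $\Sigma_2=\operatorname{diag}(\sigma_{2i}^2)_{i\le N}$, $\Sigma_5=\operatorname{diag}(\sigma_{3j}^2)_{j>N-M}$, $\Sigma_4=J\Sigma_5$, $\Sigma_3=J\Sigma_5J^\top$. All $\sigma_{1i},\sigma_{2i}\ge 0$; moreover $\sigma_{2i}>0$ for the cesium-type clocks and $\sigma_{3j}>0$ for the Hm clocks. Let $q\in\mathbb R^N$ with $q^\top\mathbf 1_N=1$, let $W\in\mathbb R^{N\times(N-1)}$ have full column rank and $q^\top W=0$, and put $V^+=W(VW)^{-1}$. The observable state is $\eta_o=((I_2\otimes V)x,\,z)$ and the unobservable state is $\eta_{\bar o}=(I_2\otimes q^\top)x$, with phase $\theta_{\bar o}=C\eta_{\bar o}$. Put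 $$\mathbf A_{oo}=\begin{pmatrix}A\otimes I_{N-1}&\beta\otimes VJ\\0&I_M\end{pmatrix},\quad \mathbf B_o=\begin{pmatrix}B\otimes V\\0\end{pmatrix},\quad \mathbf C_o=(C\otimes I_{N-1}\;\;0),\quad \mathbf T_o=\begin{pmatrix}I_2\otimes V&0\\0&I_M\end{pmatrix}.$$ **Theorem.** The Riccati equation $$P=\mathbf T_oQ\mathbf T_o^\top+\mathbf A_{oo}P\mathbf A_{oo}^\top-\mathbf A_{oo}P\mathbf C_o^\top(\mathbf C_oP\mathbf C_o^\top+rI)^{-1}\mathbf C_oP\mathbf A_{oo}^\top$$ has exactly one positive semidefinite solution $P^*$. Let $L^*=P^*\mathbf C_o^\top(\mathbf C_oP^*\mathbf C_o^\top+rI)^{-1}$ and let $\hat\eta_o$ be the estimate of the steady-state Kalman filter $$\hat\eta_o^-[k]=\mathbf A_{oo}\hat\eta_o[k-1]+\mathbf B_ou[k-1],\qquad \hat\eta_o[k]=\hat\eta_o^-[k]+L^*\big(y[k]-\mathbf C_o\hat\eta_o^-[k]\big)\qquad(k\ge1).$$ For $\gamma\in\mathbb R$ use the control $$u[k]=V^+\varphi[k],\qquad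 \varphi[k]=-\big(F\otimes I_{N-1}\;\;\;D\otimes VJ\big)\hat\eta_o[k],\qquad F=\big(\tfrac{\gamma}{\tau}\;\;1\big),\quad D=\tfrac{\tau}{2}.$$ Then the unobservable state satisfies $$\eta_{\bar o}[k+1]=A\eta_{\bar o}[k]+(\beta\otimes q^\top J)z[k]+(I_2\otimes q^\top)v^x[k].$$ For integrable random initial data $(x[0],z[0])$ and $\hat\eta_o[0]$, the vector $p[k]-\mathbf 1_N\theta_{\bar o}[k]$ is integrable for every $k$. One has $$\lim_{k\to\infty}\mathbb E\big[p[k]-\mathbf 1_N\theta_{\bar o}[k]\big]=0$$ for all integrable initial data if and only if $|1-\gamma|<1$. Moreover, for each single choice of integrable initial data with $\mathbb E\,\hat\eta_o[0]=\mathbb E\,\eta_o[0]$ and with the expected initial phases $\mathbb E\,p_i[0]$ not all equal, this limit relation holds if and only if $|1-\gamma|<1$. -/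

import Mathlib

open MeasureTheory ProbabilityTheory Filter Topology
open scoped Matrix Kronecker

noncomputable section

/-- Clocks: `n` cesium-type (Cs) clocks followed by `m` hydrogen-maser-type (Hm) clocks;
the total number of clocks is `N = n + m`. -/
abbrev Clock (n m : ℕ) : Type := Fin n ⊕ Fin m

/-- The `N - 1` measured clock differences. -/
abbrev Meas (n m : ℕ) : Type := Fin (n + m - 1)

/-- Coordinates of the ensemble state `(x, z) = ((p, f), z)`, of dimension `2 N + M`:
`inl (0, i)` is the phase `p i`, `inl (1, i)` is the frequency `f i`,
`inr j` is the frequency drift of the `j`-th Hm-type clock. -/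
abbrev StateIdx (n m : ℕ) : Type := (Fin 2 × Clock n m) ⊕ Fin m

/-- Coordinates of the observable state, of dimension `2 (N - 1) + M`. -/
abbrev ObsIdx (n m : ℕ) : Type := (Fin 2 × Meas n m) ⊕ Fin m

/-- Kronecker product `b ⊗ X` of a column vector `b ∈ ℝ²` and a matrix `X`. -/
def colKron {α κ : Type*} (b : Fin 2 → ℝ) (X : Matrix α κ ℝ) : Matrix (Fin 2 × α) κ ℝ :=
  Matrix.of fun s j => b s.1 * X s.2 j

/-- Kronecker product `c ⊗ X` of a row vector `c ∈ ℝ²` and a matrix `X`. -/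
def rowKron {α κ : Type*} (c : Fin 2 → ℝ) (X : Matrix α κ ℝ) : Matrix α (Fin 2 × κ) ℝ :=
  Matrix.of fun i s => c s.1 * X i s.2

/-- `A = [1 τ; 0 1]`. -/
def matA (τ : ℝ) : Matrix (Fin 2) (Fin 2) ℝ := !![1, τ; 0, 1]

/-- `β = [τ²/2; τ]`. -/
def vecBeta (τ : ℝ) : Fin 2 → ℝ := ![τ ^ 2 / 2, τ]

/-- `B = [τ; 1]`. -/
def vecB (τ : ℝ) : Fin 2 → ℝ := ![τ, 1]

/-- `C = [1 0]`. -/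
def vecC : Fin 2 → ℝ := ![1, 0]

/-- `J = [0; I_M]`. -/
def matJ (n m : ℕ) : Matrix (Clock n m) (Fin m) ℝ := Matrix.fromRows 0 1

/-- Parameters of a mixed ensemble of `n > 0` Cs-type and `m > 0` Hm-type clocks. -/
structure MixedEnsemble (n m : ℕ) where
  /-- sampling interval -/
  τ : ℝ
  /-- standard deviations of the white frequency noises -/
  σ₁ : Clock n m → ℝ
  /-- standard deviations of the random walk frequency noises -/
  σ₂ : Clock n m → ℝ
  /-- standard deviations of the random run noises (frequency drift) of the Hm-type clocks -/
  σ₃ : Fin m → ℝ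
  /-- variance of the measurement noise -/
  r : ℝ
  /-- the matrix of the measured clock differences -/
  V : Matrix (Meas n m) (Clock n m) ℝ
  n_pos : 0 < n
  m_pos : 0 < m
  τ_pos : 0 < τ
  σ₁_nonneg : ∀ i, 0 ≤ σ₁ i
  σ₂_nonneg : ∀ i, 0 ≤ σ₂ i
  σ₂_pos : ∀ i : Fin n, 0 < σ₂ (Sum.inl i)
  σ₃_pos : ∀ j, 0 < σ₃ j
  r_pos : 0 < r
  /-- `ker V = im 1_N` -/
  ker_V : ∀ a : Clock n m → ℝ, V *ᵥ a = 0 ↔ ∃ c : ℝ, a = fun _ => c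

/-- The data of an observable canonical decomposition: a weight vector `q` with `qᵀ 1_N = 1`
and a matrix `W ∈ ℝ^{N × (N-1)}` of full column rank with `qᵀ W = 0`. -/
structure Weighting (n m : ℕ) where
  q : Clock n m → ℝ
  W : Matrix (Clock n m) (Meas n m) ℝ
  sum_q : ∑ i, q i = 1
  rank_W : W.rank = n + m - 1
  q_W : q ᵥ* W = 0

namespace MixedEnsemble

variable {n m : ℕ} (E : MixedEnsemble n m) (D : Weighting n m)

/-! ### The ensemble model -/

/-- State matrix `[A ⊗ I_N, β ⊗ J; 0, I_M]`. -/
def stateMat : Matrix (StateIdx n m) (StateIdx n m) ℝ :=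
  Matrix.fromBlocks (matA E.τ ⊗ₖ (1 : Matrix (Clock n m) (Clock n m) ℝ))
    (colKron (vecBeta E.τ) (matJ n m)) 0 1

/-- Input matrix `[B ⊗ I_N; 0]`. -/
def inputMat : Matrix (StateIdx n m) (Clock n m) ℝ :=
  Matrix.fromRows (colKron (vecB E.τ) 1) 0

/-- Output matrix `[C ⊗ V, 0]`. -/
def outputMat : Matrix (Meas n m) (StateIdx n m) ℝ :=
  Matrix.fromCols (rowKron vecC E.V) 0

def Sigma₁ : Matrix (Clock n m) (Clock n m) ℝ := Matrix.diagonal fun i => E.σ₁ i ^ 2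

def Sigma₂ : Matrix (Clock n m) (Clock n m) ℝ := Matrix.diagonal fun i => E.σ₂ i ^ 2

def Sigma₃ : Matrix (Clock n m) (Clock n m) ℝ :=
  Matrix.diagonal (Sum.elim (fun _ => 0) fun j => E.σ₃ j ^ 2)

def Sigma₅ : Matrix (Fin m) (Fin m) ℝ := Matrix.diagonal fun j => E.σ₃ j ^ 2

def Sigma₄ : Matrix (Clock n m) (Fin m) ℝ := Matrix.fromRows 0 E.Sigma₅

/-- Covariance of the `(v^p, v^f)` part of the process noise. -/
def Qxx : Matrix (Fin 2 × Clock n m) (Fin 2 × Clock n m) ℝ :=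
  (!![E.τ, 0; 0, 0] : Matrix (Fin 2) (Fin 2) ℝ) ⊗ₖ E.Sigma₁
    + (!![E.τ ^ 3 / 3, E.τ ^ 2 / 2; E.τ ^ 2 / 2, E.τ] : Matrix (Fin 2) (Fin 2) ℝ) ⊗ₖ E.Sigma₂
    + (!![E.τ ^ 5 / 20, E.τ ^ 4 / 8; E.τ ^ 4 / 8, E.τ ^ 3 / 3] : Matrix (Fin 2) (Fin 2) ℝ)
        ⊗ₖ E.Sigma₃

/-- Cross covariance of the `(v^p, v^f)` and `v^z` parts of the process noise. -/
def Qxz : Matrix (Fin 2 × Clock n m) (Fin m) ℝ :=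
  colKron ![E.τ ^ 3 / 6, E.τ ^ 2 / 2] E.Sigma₄

/-- Covariance matrix of the process noise. -/
def Q : Matrix (StateIdx n m) (StateIdx n m) ℝ :=
  Matrix.fromBlocks E.Qxx E.Qxz E.Qxzᵀ (E.τ • E.Sigma₅)

/-! ### The observable canonical decomposition -/

/-- The generalized inverse `V⁺ = W (V W)⁻¹` of `V` associated with the weight vector `q`. -/
def Vplus : Matrix (Clock n m) (Meas n m) ℝ := D.W * (E.V * D.W)⁻¹

/-- `T_o = [I_2 ⊗ V, 0; 0, I_M]`; the observable state is `T_o (x, z)`. -/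
def To : Matrix (ObsIdx n m) (StateIdx n m) ℝ :=
  Matrix.fromBlocks ((1 : Matrix (Fin 2) (Fin 2) ℝ) ⊗ₖ E.V) 0 0 1

/-- The unobservable state `(I_2 ⊗ qᵀ) x ∈ ℝ²`: weighted averages of phases and frequencies. -/
def unobs (s : StateIdx n m → ℝ) : Fin 2 → ℝ :=
  fun a => ∑ i, D.q i * s (Sum.inl (a, i))

/-- `A_oo = [A ⊗ I_{N-1}, β ⊗ V J; 0, I_M]`. -/
def Aoo : Matrix (ObsIdx n m) (ObsIdx n m) ℝ :=
  Matrix.fromBlocks (matA E.τ ⊗ₖ (1 : Matrix (Meas n m) (Meas n m) ℝ))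
    (colKron (vecBeta E.τ) (E.V * matJ n m)) 0 1

/-- `B_o = [B ⊗ V; 0]`. -/
def Bo : Matrix (ObsIdx n m) (Clock n m) ℝ :=
  Matrix.fromRows (colKron (vecB E.τ) E.V) 0

/-- `C_o = [C ⊗ I_{N-1}, 0]`. -/
def Co (_E : MixedEnsemble n m) : Matrix (Meas n m) (ObsIdx n m) ℝ :=
  Matrix.fromCols (rowKron vecC 1) 0

/-! ### The steady-state Kalman filter for the observable state -/

/-- The Kalman gain `P C_oᵀ (C_o P C_oᵀ + r I)⁻¹` for a prior error covariance `P`. -/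
def gain (P : Matrix (ObsIdx n m) (ObsIdx n m) ℝ) : Matrix (ObsIdx n m) (Meas n m) ℝ :=
  P * E.Coᵀ * (E.Co * P * E.Coᵀ + E.r • (1 : Matrix (Meas n m) (Meas n m) ℝ))⁻¹

/-- `P` is a steady-state prior error covariance of the observable state: a positive semidefinite
solution of the algebraic Riccati equation of the filter. -/
def IsSteadyStateCov (P : Matrix (ObsIdx n m) (ObsIdx n m) ℝ) : Prop :=
  P.PosSemidef ∧
    P = E.To * E.Q * E.Toᵀ + E.Aoo * P * E.Aooᵀ
      - E.Aoo * P * E.Coᵀ * (E.Co * P * E.Coᵀ + E.r • (1 : Matrix (Meas n m) (Meas n m) ℝ))⁻¹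
        * E.Co * P * E.Aooᵀ

/-! ### The closed loop -/

/-- The control `u = V⁺ φ`, `φ = -[F ⊗ I_{N-1}, G ⊗ V J] η̂`, with `F ∈ ℝ^{1 × 2}`, `G ∈ ℝ`. -/
def control (F : Fin 2 → ℝ) (G : ℝ) (ηhat : ObsIdx n m → ℝ) : Clock n m → ℝ :=
  E.Vplus D *ᵥ
    (-(Matrix.fromCols (rowKron F (1 : Matrix (Meas n m) (Meas n m) ℝ)) (G • (E.V * matJ n m))
      *ᵥ ηhat))

/-- The ensemble state `(x[k], z[k])` and the filter estimate `η̂_o[k]` in closed loop, along one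
realization of the process noise `v` and of the measurement noise `w`, from the initial state `s₀`
and the initial estimate `ηhat₀`, for the constant filter gain `L` and feedback gains `F`, `G`. -/
def closedLoop (F : Fin 2 → ℝ) (G : ℝ) (L : Matrix (ObsIdx n m) (Meas n m) ℝ)
    (v : ℕ → StateIdx n m → ℝ) (w : ℕ → Meas n m → ℝ)
    (s₀ : StateIdx n m → ℝ) (ηhat₀ : ObsIdx n m → ℝ) :
    ℕ → (StateIdx n m → ℝ) × (ObsIdx n m → ℝ)
  | 0 => (s₀, ηhat₀)
  | k + 1 =>
    let prev := closedLoop F G L v w s₀ ηhat₀ k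
    let u := E.control D F G prev.2
    let s := E.stateMat *ᵥ prev.1 + E.inputMat *ᵥ u + v k
    let y := E.outputMat *ᵥ s + w (k + 1)
    let prior := E.Aoo *ᵥ prev.2 + E.Bo *ᵥ u
    (s, prior + L *ᵥ (y - E.Co *ᵥ prior))

/-- The ensemble state as a stochastic process, when the control uses the feedback gains
`F = [γ/τ, 1]`, `G = τ/2` and the estimates of the filter with the gain given by the prior error
covariance `P`. -/
def state (γ : ℝ) (P : Matrix (ObsIdx n m) (ObsIdx n m) ℝ) {Ω : Type*}
    (v : ℕ → Ω → StateIdx n m → ℝ) (w : ℕ → Ω → Meas n m → ℝ)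
    (s₀ : Ω → StateIdx n m → ℝ) (ηhat₀ : Ω → ObsIdx n m → ℝ) (k : ℕ) (ω : Ω) :
    StateIdx n m → ℝ :=
  (E.closedLoop D ![γ / E.τ, 1] (E.τ / 2) (E.gain P) (fun l => v l ω) (fun l => w l ω)
    (s₀ ω) (ηhat₀ ω) k).1

/-- The frequency drift part `z` of an ensemble state. -/
def drift {n m : ℕ} (s : StateIdx n m → ℝ) : Fin m → ℝ := fun j => s (Sum.inr j)

/-- The synchronization error `p - 1_N θ`, where `θ = C η` is the phase component of the
unobservable state `η`. -/
def syncError (_E : MixedEnsemble n m) (D : Weighting n m) (s : StateIdx n m → ℝ) :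
    Clock n m → ℝ :=
  fun i => s (Sum.inl (0, i)) - vecC ⬝ᵥ unobs D s

end MixedEnsemble

/-- `ξ` is a zero-mean white Gaussian noise with covariance matrix `S`. -/
structure IsWhiteGaussian {Ω ι : Type*} [MeasurableSpace Ω] [Fintype ι]
    (ξ : ℕ → Ω → ι → ℝ) (S : Matrix ι ι ℝ) (P : Measure Ω) : Prop where
  gaussian : ∀ k, HasGaussianLaw (ξ k) P
  mean : ∀ k i, ∫ ω, ξ k ω i ∂P = 0
  covariance : ∀ k i j, covariance (fun ω => ξ k ω i) (fun ω => ξ k ω j) P = S i j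
  indep : iIndepFun ξ P

end

/-!
The Riccati equation is treated through its dual control problem. For `P ≥ 0`, the form of
`riccati P` at `x` is the minimum over `u` of `P(Aᵀ x - Cᵀ u) + r |u|² + Q(x)`
(`quadForm_riccati_add`, by completing the square). Hence the map is monotone, and its iterates from
`0` increase. They are bounded because the dual system `x ↦ Aᵀ x - Cᵀ u` can be steered to zero in
three steps, at a cost that does not depend on the horizon (`MixedEnsemble.steerable`); their limit
is a solution (`exists_riccati_eq`). This is the only use of observability.

The process noise covariance is positive definite (`MixedEnsemble.posDef_Q`), and remains so on the
observable state. Therefore the form of any solution `P` strictly decreases along the transposed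
error dynamics `(A - K C)ᵀ`, which is then stable (`tendsto_pow_closedLoop_mulVec`). Of two
solutions, each dominates the other: the gain of one is admissible for the other, so the difference
of the two forms does not decrease along a stable system (`quadForm_le_of_riccati_eq`). This gives
uniqueness.

In closed loop the control cancels from the estimation error, whose mean evolves by the powers of
`(I - L C) A` and tends to zero (`tendsto_pow_filter`). The clock differences `d = V p` satisfy
`d[k+1] = (1 - γ) d[k] + τ [F, (τ/2) V J] e[k] + noise` (`MixedEnsemble.clockDiff_succ`), and
`p - 1 θ = V⁺ d` because `V⁺ V = I - 1 qᵀ`. Thus for `|1 - γ| < 1` the mean of `d` tends to zero,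
and from an unbiased estimate it equals `(1 - γ)ᵏ V E p[0]`, where `V E p[0] ≠ 0` unless the
expected phases are all equal.
-/

noncomputable section

/-! ### Quadratic forms and Lyapunov stability -/

namespace Matrix

variable {ι κ : Type*} [Fintype ι] [Fintype κ]

/-- The quadratic form `x ↦ xᵀ P x` of a square matrix. -/
def quadForm (P : Matrix ι ι ℝ) (x : ι → ℝ) : ℝ := x ⬝ᵥ P *ᵥ x

lemma continuous_quadForm (P : Matrix ι ι ℝ) : Continuous P.quadForm :=
  continuous_id.dotProduct (continuous_const.matrix_mulVec continuous_id)

@[simp]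
lemma quadForm_zero_vec (P : Matrix ι ι ℝ) : P.quadForm 0 = 0 := by simp [quadForm]

lemma dotProduct_self_nonneg_real (u : ι → ℝ) : 0 ≤ u ⬝ᵥ u := by
  simpa using dotProduct_star_self_nonneg u

lemma quadForm_smul_vec (P : Matrix ι ι ℝ) (c : ℝ) (x : ι → ℝ) :
    P.quadForm (c • x) = c ^ 2 * P.quadForm x := by
  simp only [quadForm, mulVec_smul, smul_dotProduct, dotProduct_smul, smul_eq_mul]; ring

lemma quadForm_sub_matrix (P P' : Matrix ι ι ℝ) (x : ι → ℝ) :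
    (P - P').quadForm x = P.quadForm x - P'.quadForm x := by
  simp [quadForm, sub_mulVec, dotProduct_sub]

lemma PosSemidef.transpose_eq {ι : Type*} {P : Matrix ι ι ℝ} (hP : P.PosSemidef) : Pᵀ = P := by
  simpa [IsHermitian, conjTranspose_eq_transpose_of_trivial] using hP.isHermitian

lemma PosSemidef.quadForm_nonneg {P : Matrix ι ι ℝ} (hP : P.PosSemidef) (x : ι → ℝ) :
    0 ≤ P.quadForm x := by
  simpa [quadForm] using hP.dotProduct_mulVec_nonneg x

lemma posSemidef_of_quadForm_nonneg {P : Matrix ι ι ℝ} (hs : Pᵀ = P)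
    (h : ∀ x, 0 ≤ P.quadForm x) : P.PosSemidef :=
  .of_dotProduct_mulVec_nonneg (by simpa [IsHermitian, conjTranspose_eq_transpose_of_trivial])
    fun x => by simpa [quadForm] using h x

lemma dotProduct_mulVec_comm_of_symm {P : Matrix ι ι ℝ} (hs : Pᵀ = P) (x y : ι → ℝ) :
    x ⬝ᵥ P *ᵥ y = y ⬝ᵥ P *ᵥ x := by
  rw [dotProduct_mulVec, ← mulVec_transpose, hs, dotProduct_comm]

lemma quadForm_add_vec {P : Matrix ι ι ℝ} (hs : Pᵀ = P) (x y : ι → ℝ) :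
    P.quadForm (x + y) = P.quadForm x + 2 * (x ⬝ᵥ P *ᵥ y) + P.quadForm y := by
  simp only [quadForm, mulVec_add, add_dotProduct, dotProduct_add,
    dotProduct_mulVec_comm_of_symm hs y x]
  ring

lemma quadForm_sub_vec {P : Matrix ι ι ℝ} (hs : Pᵀ = P) (x y : ι → ℝ) :
    P.quadForm (x - y) = P.quadForm x - 2 * (x ⬝ᵥ P *ᵥ y) + P.quadForm y := by
  simp only [quadForm, mulVec_sub, sub_dotProduct, dotProduct_sub,
    dotProduct_mulVec_comm_of_symm hs y x]
  ring

/-- Polarization: the entries of a symmetric matrix in terms of its quadratic form. -/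
lemma apply_eq_quadForm [DecidableEq ι] {P : Matrix ι ι ℝ} (hs : Pᵀ = P) (i j : ι) :
    P i j = (P.quadForm (Pi.single i 1 + Pi.single j 1) - P.quadForm (Pi.single i 1)
      - P.quadForm (Pi.single j 1)) / 2 := by
  rw [quadForm_add_vec hs]
  simp only [mulVec_single_one, single_one_dotProduct, col_apply]
  ring

lemma eq_of_quadForm_eq [DecidableEq ι] {P P' : Matrix ι ι ℝ} (hs : Pᵀ = P) (hs' : P'ᵀ = P')
    (h : ∀ x, P.quadForm x = P'.quadForm x) : P = P' := by
  ext i j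
  rw [apply_eq_quadForm hs, apply_eq_quadForm hs', h, h, h]

/-- The ratio of two continuous functions, homogeneous of degree two, of which the denominator is
positive away from the origin, attains its maximum (on the unit sphere). -/
lemma exists_forall_le_ratio_mul [Nonempty ι] {f g : (ι → ℝ) → ℝ} (hf : Continuous f)
    (hg : Continuous g) (hfh : ∀ (c : ℝ) x, f (c • x) = c ^ 2 * f x)
    (hgh : ∀ (c : ℝ) x, g (c • x) = c ^ 2 * g x) (hpos : ∀ x, x ≠ 0 → 0 < g x) :
    ∃ x₀, x₀ ≠ 0 ∧ ∀ x, f x ≤ f x₀ / g x₀ * g x := by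
  have hne : ∀ x ∈ Metric.sphere (0 : ι → ℝ) 1, x ≠ 0 := fun x hx =>
    ne_zero_of_mem_sphere one_ne_zero ⟨x, hx⟩
  obtain ⟨x₀, hx₀, hmax⟩ := (isCompact_sphere (0 : ι → ℝ) 1).exists_isMaxOn
    (NormedSpace.sphere_nonempty.2 zero_le_one)
    (f := fun x => f x / g x)
    (hf.continuousOn.div hg.continuousOn fun x hx => (hpos x (hne x hx)).ne')
  refine ⟨x₀, hne _ hx₀, fun x => ?_⟩
  rcases eq_or_ne x 0 with rfl | hx
  · have h0 := hfh 0 0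
    have h1 := hgh 0 0
    simp only [smul_zero] at h0 h1
    rw [h0, h1]; simp
  · have hn : ‖x‖ ≠ 0 := norm_ne_zero_iff.2 hx
    have hmem : ‖x‖⁻¹ • x ∈ Metric.sphere (0 : ι → ℝ) 1 := by
      simp [norm_smul, hn]
    have h := hmax hmem
    simp only [Set.mem_ofPred_eq, hfh, hgh] at h
    rw [mul_div_mul_left _ _ (by positivity)] at h
    exact (div_le_iff₀ (hpos x hx)).1 h

/-- A Lyapunov criterion: if the positive semidefinite form `P` strictly decreases along `F`, then
the iterates of `F` tend to zero. -/
theorem tendsto_pow_mulVec_of_quadForm [DecidableEq ι] {P F : Matrix ι ι ℝ} (hP : P.PosSemidef)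
    (hlt : ∀ x, x ≠ 0 → P.quadForm (F *ᵥ x) < P.quadForm x) (x : ι → ℝ) :
    Tendsto (fun k : ℕ => (F ^ k) *ᵥ x) atTop (𝓝 0) := by
  rcases isEmpty_or_nonempty ι with hι | hι
  · rw [show (fun k : ℕ => (F ^ k) *ᵥ x) = fun _ => 0 from funext fun k => Subsingleton.elim _ _]
    exact tendsto_const_nhds
  have hpos : ∀ y, y ≠ 0 → 0 < P.quadForm y := fun y hy =>
    (hP.quadForm_nonneg _).trans_lt (hlt y hy)
  obtain ⟨y, hy, hρ⟩ := exists_forall_le_ratio_mul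
    (f := fun x => P.quadForm (F *ᵥ x)) (g := P.quadForm)
    (P.continuous_quadForm.comp (continuous_const.matrix_mulVec continuous_id))
    P.continuous_quadForm (fun c x => by rw [mulVec_smul, quadForm_smul_vec])
    P.quadForm_smul_vec hpos
  set ρ := P.quadForm (F *ᵥ y) / P.quadForm y
  have hρ0 : 0 ≤ ρ := div_nonneg (hP.quadForm_nonneg _) (hP.quadForm_nonneg _)
  have hρ1 : ρ < 1 := (div_lt_one (hpos y hy)).2 (hlt y hy)
  obtain ⟨z, -, hc⟩ := exists_forall_le_ratio_mul
    (f := fun x : ι → ℝ => ‖x‖ ^ 2) (g := P.quadForm) (by fun_prop)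
    P.continuous_quadForm (fun c x => by rw [norm_smul, mul_pow]; simp)
    P.quadForm_smul_vec hpos
  set c := ‖z‖ ^ 2 / P.quadForm z
  have hgeom : ∀ k : ℕ, P.quadForm ((F ^ k) *ᵥ x) ≤ ρ ^ k * P.quadForm x := by
    intro k
    induction k with
    | zero => simp
    | succ k ih =>
      rw [pow_succ', ← mulVec_mulVec, pow_succ', mul_assoc]
      exact (hρ _).trans (mul_le_mul_of_nonneg_left ih hρ0)
  have hlim : Tendsto (fun k : ℕ => P.quadForm ((F ^ k) *ᵥ x)) atTop (𝓝 0) :=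
    squeeze_zero (fun k => hP.quadForm_nonneg _) hgeom
      (by simpa using (tendsto_pow_atTop_nhds_zero_of_lt_one hρ0 hρ1).mul_const (P.quadForm x))
  have hsq : Tendsto (fun k : ℕ => ‖(F ^ k) *ᵥ x‖ ^ 2) atTop (𝓝 0) :=
    squeeze_zero (fun k => by positivity) (fun k => hc _) (by simpa using hlim.const_mul c)
  rw [tendsto_zero_iff_norm_tendsto_zero]
  simpa using hsq.sqrt

lemma tendsto_zero_of_forall_mulVec {μ : Type*} [DecidableEq ι]
    {X : ℕ → Matrix μ ι ℝ} (h : ∀ x, Tendsto (fun k => X k *ᵥ x) atTop (𝓝 0)) :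
    Tendsto X atTop (𝓝 0) := by
  refine tendsto_pi_nhds.2 fun i => tendsto_pi_nhds.2 fun j => ?_
  simpa using (tendsto_pi_nhds.1 (h (Pi.single j 1))) i

lemma tendsto_matrix_mul {α μ ν : Type*} {l : Filter α} {f : α → Matrix μ ι ℝ}
    {g : α → Matrix ι ν ℝ} {a : Matrix μ ι ℝ} {b : Matrix ι ν ℝ} (hf : Tendsto f l (𝓝 a))
    (hg : Tendsto g l (𝓝 b)) : Tendsto (fun k => f k * g k) l (𝓝 (a * b)) :=
  ((continuous_fst.matrix_mul continuous_snd).tendsto (a, b)).comp (hf.prodMk_nhds hg)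

end Matrix

open Matrix

section General

variable {ι κ : Type*} [Fintype ι] [Fintype κ]

/-! ### The Riccati equation -/

section Riccati

variable [DecidableEq κ]

/-- The one-step predictor gain `A P Cᵀ (C P Cᵀ + r I)⁻¹`. -/
def predictorGain (A : Matrix ι ι ℝ) (C : Matrix κ ι ℝ) (r : ℝ) (P : Matrix ι ι ℝ) :
    Matrix ι κ ℝ :=
  A * P * Cᵀ * (C * P * Cᵀ + r • (1 : Matrix κ κ ℝ))⁻¹

/-- The right-hand side of the Riccati equation, a map on prior error covariances. -/
def riccati (A : Matrix ι ι ℝ) (C : Matrix κ ι ℝ) (Q : Matrix ι ι ℝ) (r : ℝ)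
    (P : Matrix ι ι ℝ) : Matrix ι ι ℝ :=
  Q + A * P * Aᵀ - A * P * Cᵀ * (C * P * Cᵀ + r • (1 : Matrix κ κ ℝ))⁻¹ * C * P * Aᵀ

variable {A : Matrix ι ι ℝ} {C : Matrix κ ι ℝ} {Q : Matrix ι ι ℝ} {r : ℝ} {P P' : Matrix ι ι ℝ}

lemma posDef_innovation (hr : 0 < r) (hP : P.PosSemidef) :
    (C * P * Cᵀ + r • (1 : Matrix κ κ ℝ)).PosDef := by
  have h := hP.mul_mul_conjTranspose_same C
  rw [conjTranspose_eq_transpose_of_trivial] at h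
  exact PosDef.posSemidef_add h (PosDef.one.smul hr)

lemma transpose_riccati (hQ : Q.PosSemidef) (hr : 0 < r) (hP : P.PosSemidef) :
    (riccati A C Q r P)ᵀ = riccati A C Q r P := by
  have hS := (posDef_innovation (C := C) hr hP).posSemidef.transpose_eq
  simp only [riccati, transpose_sub, transpose_add, transpose_mul, transpose_nonsing_inv,
    transpose_transpose, hQ.transpose_eq, hP.transpose_eq, transpose_smul, transpose_one,
    Matrix.mul_assoc]

/-- Completion of squares: the cost of the input `u` for the dual control problem, with terminal
cost `P`, exceeds the value `riccati P` by a positive form in `u - Kᵀ x`, where `K` is the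
predictor gain. -/
lemma quadForm_riccati_add (hr : 0 < r) (hP : P.PosSemidef) (x : ι → ℝ)
    (u : κ → ℝ) :
    P.quadForm (Aᵀ *ᵥ x - Cᵀ *ᵥ u) + r * (u ⬝ᵥ u) + Q.quadForm x =
      (riccati A C Q r P).quadForm x
        + (C * P * Cᵀ + r • (1 : Matrix κ κ ℝ)).quadForm (u - (predictorGain A C r P)ᵀ *ᵥ x) := by
  have hS := posDef_innovation (C := C) hr hP
  have hSu : IsUnit (C * P * Cᵀ + r • (1 : Matrix κ κ ℝ)).det :=
    (isUnit_iff_isUnit_det _).1 hS.isUnit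
  have hSs := hS.posSemidef.transpose_eq
  set S := C * P * Cᵀ + r • (1 : Matrix κ κ ℝ) with hSdef
  set y := C *ᵥ P *ᵥ Aᵀ *ᵥ x with hy
  have hK : (predictorGain A C r P)ᵀ *ᵥ x = S⁻¹ *ᵥ y := by
    simp only [predictorGain, transpose_mul, transpose_nonsing_inv, ← hSdef, hSs, hP.transpose_eq,
      transpose_transpose, ← mulVec_mulVec, hy]
  have h1 : (riccati A C Q r P).quadForm x
      = Q.quadForm x + P.quadForm (Aᵀ *ᵥ x) - y ⬝ᵥ S⁻¹ *ᵥ y := by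
    have e1 : x ⬝ᵥ A *ᵥ P *ᵥ Aᵀ *ᵥ x = P.quadForm (Aᵀ *ᵥ x) := by
      rw [quadForm, dotProduct_mulVec, ← mulVec_transpose]
    have e2 : x ⬝ᵥ A *ᵥ P *ᵥ Cᵀ *ᵥ S⁻¹ *ᵥ y = y ⬝ᵥ S⁻¹ *ᵥ y := by
      rw [dotProduct_mulVec, ← mulVec_transpose, dotProduct_mulVec, ← mulVec_transpose,
        hP.transpose_eq,
        dotProduct_mulVec, vecMul_transpose]
    rw [riccati, quadForm, sub_mulVec, add_mulVec, dotProduct_sub, dotProduct_add]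
    simp only [← hSdef, ← mulVec_mulVec]
    rw [← hy, e1, e2, ← quadForm]
  have h2 : S.quadForm (u - S⁻¹ *ᵥ y) = S.quadForm u - 2 * (u ⬝ᵥ y) + y ⬝ᵥ S⁻¹ *ᵥ y := by
    have e : S *ᵥ S⁻¹ *ᵥ y = y := by rw [mulVec_mulVec, mul_nonsing_inv _ hSu, one_mulVec]
    rw [quadForm_sub_vec hSs, e, quadForm, quadForm, e, dotProduct_comm (S⁻¹ *ᵥ y) y]
  have h3 : P.quadForm (Aᵀ *ᵥ x - Cᵀ *ᵥ u)
      = P.quadForm (Aᵀ *ᵥ x) - 2 * (u ⬝ᵥ y) + P.quadForm (Cᵀ *ᵥ u) := by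
    rw [quadForm_sub_vec hP.transpose_eq, dotProduct_mulVec_comm_of_symm hP.transpose_eq _
      (Cᵀ *ᵥ u),
      dotProduct_comm (Cᵀ *ᵥ u), dotProduct_mulVec _ Cᵀ, vecMul_transpose, dotProduct_comm _ u]
  have h4 : S.quadForm u = P.quadForm (Cᵀ *ᵥ u) + r * (u ⬝ᵥ u) := by
    rw [quadForm, hSdef, add_mulVec, dotProduct_add, smul_mulVec, one_mulVec, dotProduct_smul,
      smul_eq_mul, ← mulVec_mulVec, ← mulVec_mulVec, dotProduct_mulVec, ← mulVec_transpose,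
      quadForm]
  rw [hK, h1, h2, h3, h4]
  ring

/-- `riccati P` is the optimal value of the dual control problem with terminal cost `P`. -/
lemma quadForm_riccati_le (hr : 0 < r) (hP : P.PosSemidef) (x : ι → ℝ) (u : κ → ℝ) :
    (riccati A C Q r P).quadForm x ≤
      P.quadForm (Aᵀ *ᵥ x - Cᵀ *ᵥ u) + r * (u ⬝ᵥ u) + Q.quadForm x := by
  rw [quadForm_riccati_add hr hP]
  linarith [(posDef_innovation (C := C) hr hP).posSemidef.quadForm_nonneg
    (u - (predictorGain A C r P)ᵀ *ᵥ x)]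

/-- The optimal value is attained by the feedback `u = Kᵀ x`. -/
lemma quadForm_riccati_eq (hr : 0 < r) (hP : P.PosSemidef) (x : ι → ℝ) :
    (riccati A C Q r P).quadForm x =
      P.quadForm ((A - predictorGain A C r P * C)ᵀ *ᵥ x)
        + r * ((predictorGain A C r P)ᵀ *ᵥ x ⬝ᵥ (predictorGain A C r P)ᵀ *ᵥ x)
        + Q.quadForm x := by
  have h := quadForm_riccati_add (A := A) (C := C) (Q := Q) hr hP x
    ((predictorGain A C r P)ᵀ *ᵥ x)
  rw [sub_self, quadForm_zero_vec, add_zero] at h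
  rw [← h, transpose_sub, transpose_mul, sub_mulVec, ← mulVec_mulVec]

lemma posSemidef_riccati (hQ : Q.PosSemidef) (hr : 0 < r) (hP : P.PosSemidef) :
    (riccati A C Q r P).PosSemidef := by
  refine posSemidef_of_quadForm_nonneg (transpose_riccati hQ hr hP) fun x => ?_
  rw [quadForm_riccati_eq hr hP]
  have := hP.quadForm_nonneg ((A - predictorGain A C r P * C)ᵀ *ᵥ x)
  have := mul_nonneg hr.le (dotProduct_self_nonneg_real ((predictorGain A C r P)ᵀ *ᵥ x))
  have := hQ.quadForm_nonneg x
  positivity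

/-- The Riccati map is monotone: the optimal gain for `P'` is admissible for `P`. -/
lemma quadForm_riccati_mono (hr : 0 < r) (hP : P.PosSemidef) (hP' : P'.PosSemidef)
    (h : ∀ x, P.quadForm x ≤ P'.quadForm x) (x : ι → ℝ) :
    (riccati A C Q r P).quadForm x ≤ (riccati A C Q r P').quadForm x := by
  rw [quadForm_riccati_eq hr hP']
  refine (quadForm_riccati_le hr hP x ((predictorGain A C r P')ᵀ *ᵥ x)).trans ?_
  rw [transpose_sub, transpose_mul, sub_mulVec, ← mulVec_mulVec]
  linarith [h (Aᵀ *ᵥ x - Cᵀ *ᵥ (predictorGain A C r P')ᵀ *ᵥ x)]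

lemma continuousAt_riccati (hr : 0 < r) (hP : P.PosSemidef) :
    ContinuousAt (riccati A C Q r) P := by
  have hdet : (C * P * Cᵀ + r • (1 : Matrix κ κ ℝ)).det ≠ 0 :=
    ((isUnit_iff_isUnit_det _).1 (posDef_innovation (C := C) hr hP).isUnit).ne_zero
  have hS : Continuous fun P : Matrix ι ι ℝ => C * P * Cᵀ + r • (1 : Matrix κ κ ℝ) := by fun_prop
  have hinv : Tendsto (fun P : Matrix ι ι ℝ => (C * P * Cᵀ + r • (1 : Matrix κ κ ℝ))⁻¹) (𝓝 P)
      (𝓝 (C * P * Cᵀ + r • (1 : Matrix κ κ ℝ))⁻¹) := by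
    refine (continuousAt_matrix_inv (C * P * Cᵀ + r • (1 : Matrix κ κ ℝ)) ?_).tendsto.comp
      (hS.tendsto P)
    rw [Ring.inverse_eq_inv']
    exact continuousAt_inv₀ hdet
  have h1 : Continuous fun P : Matrix ι ι ℝ => Q + A * P * Aᵀ := by fun_prop
  have h2 : Continuous fun P : Matrix ι ι ℝ => A * P * Cᵀ := by fun_prop
  have h3 : Continuous fun P : Matrix ι ι ℝ => C * P * Aᵀ := by fun_prop
  have h4 := tendsto_matrix_mul (tendsto_matrix_mul (h2.tendsto P) hinv) (h3.tendsto P)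
  unfold ContinuousAt riccati
  simp only [Matrix.mul_assoc] at h1 h4 ⊢
  exact (h1.tendsto P).sub h4

/-- `Steerable A C N x`: some `N` inputs steer the state `x` of the dual system
`x ↦ Aᵀ x - Cᵀ u` to zero. -/
def Steerable (A : Matrix ι ι ℝ) (C : Matrix κ ι ℝ) : ℕ → (ι → ℝ) → Prop
  | 0, x => x = 0
  | N + 1, x => ∃ u : κ → ℝ, Steerable A C N (Aᵀ *ᵥ x - Cᵀ *ᵥ u)

lemma posSemidef_iterate_riccati (hQ : Q.PosSemidef) (hr : 0 < r) (k : ℕ) :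
    ((riccati A C Q r)^[k] 0).PosSemidef := by
  induction k with
  | zero => exact PosSemidef.zero
  | succ k ih => rw [Function.iterate_succ_apply']; exact posSemidef_riccati hQ hr ih

lemma monotone_quadForm_iterate_riccati (hQ : Q.PosSemidef) (hr : 0 < r) (x : ι → ℝ) :
    Monotone fun k => ((riccati A C Q r)^[k] 0).quadForm x := by
  suffices h : ∀ k x, ((riccati A C Q r)^[k] 0).quadForm x
      ≤ ((riccati A C Q r)^[k + 1] 0).quadForm x from monotone_nat_of_le_succ fun k => h k x
  intro k
  induction k with
  | zero =>
    intro x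
    simpa [quadForm] using (posSemidef_iterate_riccati (A := A) (C := C) hQ hr 1).quadForm_nonneg x
  | succ k ih =>
    intro x
    rw [Function.iterate_succ_apply', Function.iterate_succ_apply' _ (k + 1)]
    exact quadForm_riccati_mono hr (posSemidef_iterate_riccati hQ hr _)
      (posSemidef_iterate_riccati hQ hr _) ih x

/-- The iterates are bounded at `x`, because the inputs that steer `x` to zero have a finite cost,
whatever the horizon. -/
lemma Steerable.exists_quadForm_iterate_le (hQ : Q.PosSemidef) (hr : 0 < r) {N : ℕ} {x : ι → ℝ}
    (hx : Steerable A C N x) : ∃ c, ∀ k, ((riccati A C Q r)^[k] 0).quadForm x ≤ c := by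
  suffices h : ∃ c, ∀ k, ((riccati A C Q r)^[k + N] 0).quadForm x ≤ c by
    obtain ⟨c, hc⟩ := h
    exact ⟨c, fun k =>
      (monotone_quadForm_iterate_riccati hQ hr x (Nat.le_add_right k N)).trans (hc k)⟩
  induction N generalizing x with
  | zero => exact ⟨0, fun k => by rw [show x = 0 from hx]; simp [quadForm]⟩
  | succ N ih =>
    obtain ⟨u, hu⟩ := hx
    obtain ⟨c, hc⟩ := ih hu
    refine ⟨c + r * (u ⬝ᵥ u) + Q.quadForm x, fun k => ?_⟩
    rw [← add_assoc, Function.iterate_succ_apply']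
    refine (quadForm_riccati_le hr (posSemidef_iterate_riccati hQ hr _) x u).trans ?_
    linarith [hc k]

/-- The increasing, bounded iterates from the zero covariance converge to a solution. -/
theorem exists_riccati_eq [DecidableEq ι] (hQ : Q.PosSemidef) (hr : 0 < r) {N : ℕ}
    (hC : ∀ x, Steerable A C N x) : ∃ P : Matrix ι ι ℝ, P.PosSemidef ∧ P = riccati A C Q r P := by
  set X : ℕ → Matrix ι ι ℝ := fun k => (riccati A C Q r)^[k] 0 with hX
  have hpsd : ∀ k, (X k).PosSemidef := posSemidef_iterate_riccati hQ hr
  have hlim : ∀ x, ∃ l, Tendsto (fun k => (X k).quadForm x) atTop (𝓝 l) := fun x => by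
    obtain ⟨c, hc⟩ := (hC x).exists_quadForm_iterate_le hQ hr
    exact ⟨_, tendsto_atTop_ciSup (monotone_quadForm_iterate_riccati hQ hr x)
      ⟨c, by rintro _ ⟨k, rfl⟩; exact hc k⟩⟩
  choose l hl using hlim
  -- the entries converge by polarization
  obtain ⟨P, hP⟩ : ∃ P, Tendsto X atTop (𝓝 P) := by
    refine ⟨Matrix.of fun i j => (l (Pi.single i 1 + Pi.single j 1) - l (Pi.single i 1)
      - l (Pi.single j 1)) / 2, tendsto_pi_nhds.2 fun i => tendsto_pi_nhds.2 fun j => ?_⟩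
    simp only [fun k => apply_eq_quadForm (hpsd k).transpose_eq i j]
    exact (((hl _).sub (hl _)).sub (hl _)).div_const 2
  have hPpsd : P.PosSemidef := by
    refine posSemidef_of_quadForm_nonneg ?_ fun x => ?_
    · refine tendsto_nhds_unique (((continuous_id.matrix_transpose).tendsto P).comp hP) ?_
      refine hP.congr fun k => ((hpsd k).transpose_eq).symm
    · have hc : Continuous fun P : Matrix ι ι ℝ => P.quadForm x := by
        unfold quadForm; fun_prop
      exact ge_of_tendsto' ((hc.tendsto P).comp hP) fun k => (hpsd k).quadForm_nonneg x
  refine ⟨P, hPpsd, tendsto_nhds_unique (hP.comp (tendsto_add_atTop_nat 1)) ?_⟩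
  refine ((continuousAt_riccati hr hPpsd).tendsto.comp hP).congr fun k => ?_
  simp only [hX, Function.comp_apply, Function.iterate_succ_apply']

/-- The error dynamics of the predictor built from any positive semidefinite solution of the
Riccati equation are stable if the process noise is nondegenerate: the form of the solution itself
is a Lyapunov function for the transposed dynamics. -/
theorem tendsto_pow_closedLoop_mulVec [DecidableEq ι] (hQ : Q.PosDef) (hr : 0 < r)
    (hP : P.PosSemidef) (heq : P = riccati A C Q r P) (x : ι → ℝ) :
    Tendsto (fun k : ℕ => ((A - predictorGain A C r P * C)ᵀ ^ k) *ᵥ x) atTop (𝓝 0) := by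
  refine tendsto_pow_mulVec_of_quadForm hP (fun x hx => ?_) x
  have hstep := quadForm_riccati_eq (A := A) (C := C) (Q := Q) hr hP x
  rw [← heq] at hstep
  have hK0 := mul_nonneg hr.le (dotProduct_self_nonneg_real ((predictorGain A C r P)ᵀ *ᵥ x))
  have hQ0 : 0 < Q.quadForm x := by simpa [quadForm] using hQ.dotProduct_mulVec_pos hx
  linarith

/-- Of two solutions, one with a stable predictor dominates the other, because the gain of the
former is admissible, not optimal, for the latter. -/
lemma quadForm_le_of_riccati_eq [DecidableEq ι] (hr : 0 < r) (hP : P.PosSemidef)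
    (hP' : P'.PosSemidef) (heq : P = riccati A C Q r P) (heq' : P' = riccati A C Q r P')
    (hstab : ∀ x, Tendsto (fun k : ℕ => ((A - predictorGain A C r P' * C)ᵀ ^ k) *ᵥ x) atTop (𝓝 0))
    (x : ι → ℝ) : P.quadForm x ≤ P'.quadForm x := by
  set K := predictorGain A C r P'
  set F := (A - K * C)ᵀ with hF
  have hstep : ∀ x, (P - P').quadForm x ≤ (P - P').quadForm (F *ᵥ x) := fun x => by
    have h1 := quadForm_riccati_le (A := A) (C := C) (Q := Q) hr hP x (Kᵀ *ᵥ x)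
    rw [← heq] at h1
    have h2 := quadForm_riccati_eq (A := A) (C := C) (Q := Q) hr hP' x
    rw [← heq'] at h2
    have h3 : Aᵀ *ᵥ x - Cᵀ *ᵥ Kᵀ *ᵥ x = F *ᵥ x := by
      rw [hF, transpose_sub, transpose_mul, sub_mulVec, ← mulVec_mulVec]
    rw [h3] at h1
    rw [quadForm_sub_matrix, quadForm_sub_matrix]
    change _ = P'.quadForm (F *ᵥ x) + r * (Kᵀ *ᵥ x ⬝ᵥ Kᵀ *ᵥ x) + Q.quadForm x at h2
    linarith
  have hiter : ∀ k : ℕ, (P - P').quadForm x ≤ (P - P').quadForm ((F ^ k) *ᵥ x) := by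
    intro k
    induction k with
    | zero => simp
    | succ k ih =>
      rw [pow_succ', ← mulVec_mulVec]
      exact ih.trans (hstep _)
  have hlim : Tendsto (fun k : ℕ => (P - P').quadForm ((F ^ k) *ᵥ x)) atTop (𝓝 0) := by
    have h := ((P - P').continuous_quadForm.tendsto 0).comp (hstab x)
    rwa [show (P - P').quadForm 0 = 0 by simp [quadForm]] at h
  have := ge_of_tendsto' hlim hiter
  rw [quadForm_sub_matrix] at this
  linarith

/-- The Riccati equation with nondegenerate process noise and steerable dual system has exactly one
positive semidefinite solution. -/
theorem exists_unique_riccati_eq [DecidableEq ι] (hQ : Q.PosDef) (hr : 0 < r) {N : ℕ}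
    (hC : ∀ x, Steerable A C N x) :
    ∃ P : Matrix ι ι ℝ, (P.PosSemidef ∧ P = riccati A C Q r P) ∧
      ∀ P' : Matrix ι ι ℝ, P'.PosSemidef ∧ P' = riccati A C Q r P' → P' = P := by
  obtain ⟨P, hP, heq⟩ := exists_riccati_eq hQ.posSemidef hr hC
  refine ⟨P, ⟨hP, heq⟩, fun P' ⟨hP', heq'⟩ => ?_⟩
  refine eq_of_quadForm_eq hP'.transpose_eq hP.transpose_eq fun x => le_antisymm ?_ ?_
  · exact quadForm_le_of_riccati_eq hr hP' hP heq' heq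
      (tendsto_pow_closedLoop_mulVec hQ hr hP heq) x
  · exact quadForm_le_of_riccati_eq hr hP hP' heq heq'
      (tendsto_pow_closedLoop_mulVec hQ hr hP' heq') x

/-- The error dynamics `(I - L C) A` of the filter have the same powers as those of the predictor,
up to one step. -/
theorem tendsto_pow_filter [DecidableEq ι] (hQ : Q.PosDef) (hr : 0 < r) (hP : P.PosSemidef)
    (heq : P = riccati A C Q r P) {L : Matrix ι κ ℝ} (hL : A * L = predictorGain A C r P) :
    Tendsto (fun k : ℕ => ((1 - L * C) * A) ^ k) atTop (𝓝 0) := by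
  set X := A - predictorGain A C r P * C with hX
  have hX' : A * (1 - L * C) = X := by
    rw [Matrix.mul_sub, Matrix.mul_one, ← Matrix.mul_assoc, hL]
  have hlim : Tendsto (fun k : ℕ => X ^ k) atTop (𝓝 0) := by
    have h := tendsto_zero_of_forall_mulVec (tendsto_pow_closedLoop_mulVec hQ hr hP heq)
    have h' := ((continuous_id.matrix_transpose).tendsto (0 : Matrix ι ι ℝ)).comp h
    rw [id, transpose_zero] at h'
    exact h'.congr fun k => by rw [Function.comp_apply, id, ← transpose_pow, transpose_transpose]
  have hpow : ∀ k : ℕ, ((1 - L * C) * A) ^ (k + 1) = (1 - L * C) * X ^ k * A := by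
    intro k
    induction k with
    | zero => simp
    | succ k ih => rw [pow_succ, ih, pow_succ X, ← hX']; simp only [Matrix.mul_assoc]
  rw [← tendsto_add_atTop_iff_nat 1]
  simp only [hpow]
  simpa using (tendsto_matrix_mul (tendsto_matrix_mul
    (tendsto_const_nhds (x := 1 - L * C)) hlim) (tendsto_const_nhds (x := A)))

end Riccati

/-! ### Perturbed recursions and expectations -/

/-- A stable scalar recursion with a vanishing input tends to zero. -/
lemma tendsto_zero_of_recursion {X : Type*} [NormedAddCommGroup X] [NormedSpace ℝ X] {ρ : ℝ}
    (hρ : |ρ| < 1) {a d : ℕ → X} (ha : ∀ k, a (k + 1) = ρ • a k + d k)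
    (hd : Tendsto d atTop (𝓝 0)) : Tendsto a atTop (𝓝 0) := by
  rw [Metric.tendsto_atTop]
  intro ε hε
  have hgap : 0 < 1 - |ρ| := by linarith
  obtain ⟨K, hK⟩ := Metric.tendsto_atTop.1 hd (ε / 2 * (1 - |ρ|)) (by positivity)
  have hbound : ∀ j, ‖a (K + j)‖ ≤ |ρ| ^ j * ‖a K‖ + ε / 2 := by
    intro j
    induction j with
    | zero => simp; positivity
    | succ j ih =>
      have h1 := (hK (K + j) (by omega)).le
      rw [dist_zero_right] at h1
      have h2 := norm_add_le (ρ • a (K + j)) (d (K + j))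
      rw [norm_smul, Real.norm_eq_abs, ← ha] at h2
      have h3 := mul_le_mul_of_nonneg_left ih (abs_nonneg ρ)
      rw [← add_assoc, pow_succ]
      nlinarith
  have hlim : Tendsto (fun j : ℕ => |ρ| ^ j * ‖a K‖) atTop (𝓝 0) := by
    simpa using (tendsto_pow_atTop_nhds_zero_of_lt_one (abs_nonneg ρ) hρ).mul_const ‖a K‖
  obtain ⟨J, hJ⟩ := Metric.tendsto_atTop.1 hlim (ε / 2) (by positivity)
  refine ⟨K + J, fun k hk => ?_⟩
  obtain ⟨j, rfl⟩ := Nat.exists_eq_add_of_le (Nat.le_of_add_right_le hk)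
  have h1 := hJ j (by omega)
  rw [Real.dist_0_eq_abs] at h1
  rw [dist_zero_right]
  linarith [hbound j, le_abs_self (|ρ| ^ j * ‖a K‖)]

section Expectation

variable {Ω : Type*} [MeasurableSpace Ω] {μ : Measure Ω}

lemma integrable_mulVec (M : Matrix κ ι ℝ) {X : Ω → ι → ℝ} (hX : Integrable X μ) :
    Integrable (fun ω => M *ᵥ X ω) μ :=
  (LinearMap.toContinuousLinearMap M.mulVecLin).integrable_comp hX

lemma integral_mulVec (M : Matrix κ ι ℝ) {X : Ω → ι → ℝ} (hX : Integrable X μ) :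
    ∫ ω, M *ᵥ X ω ∂μ = M *ᵥ ∫ ω, X ω ∂μ :=
  (LinearMap.toContinuousLinearMap M.mulVecLin).integral_comp_comm hX

lemma IsWhiteGaussian.integrable {ξ : ℕ → Ω → ι → ℝ} {S : Matrix ι ι ℝ}
    (h : IsWhiteGaussian ξ S μ) (k : ℕ) : Integrable (ξ k) μ :=
  (h.gaussian k).integrable

lemma IsWhiteGaussian.integral_eq_zero {ξ : ℕ → Ω → ι → ℝ} {S : Matrix ι ι ℝ}
    (h : IsWhiteGaussian ξ S μ) (k : ℕ) : ∫ ω, ξ k ω ∂μ = 0 := by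
  ext i
  rw [eval_integral fun i => (h.integrable k).eval i, h.mean]
  rfl

end Expectation

end General

/-! ### Block vectors -/

/-- The vector with phase part `a`, frequency part `b` and drift part `c`; it serves both for
ensemble states and for observable states. -/
def blockVec {α μ : Type*} (a b : α → ℝ) (c : μ → ℝ) : (Fin 2 × α) ⊕ μ → ℝ :=
  Sum.elim (fun s => ![a, b] s.1 s.2) c

section BlockVec

variable {α μ : Type*} (a b : α → ℝ) (c : μ → ℝ)

@[simp] lemma blockVec_phase (i : α) : blockVec a b c (Sum.inl (0, i)) = a i := rfl

@[simp] lemma blockVec_freq (i : α) : blockVec a b c (Sum.inl (1, i)) = b i := rfl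

@[simp] lemma blockVec_drift (j : μ) : blockVec a b c (Sum.inr j) = c j := rfl

lemma exists_eq_blockVec (x : (Fin 2 × α) ⊕ μ → ℝ) : ∃ a b c, x = blockVec a b c := by
  refine ⟨fun i => x (Sum.inl (0, i)), fun i => x (Sum.inl (1, i)), fun j => x (Sum.inr j), ?_⟩
  ext (⟨s, i⟩ | j)
  · fin_cases s <;> rfl
  · rfl

lemma blockVec_ext {x y : (Fin 2 × α) ⊕ μ → ℝ} (h0 : ∀ i, x (Sum.inl (0, i)) = y (Sum.inl (0, i)))
    (h1 : ∀ i, x (Sum.inl (1, i)) = y (Sum.inl (1, i))) (h2 : ∀ j, x (Sum.inr j) = y (Sum.inr j)) :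
    x = y := by
  ext (⟨s, i⟩ | j)
  · fin_cases s
    exacts [h0 i, h1 i]
  · exact h2 j

lemma blockVec_sub (a' b' : α → ℝ) (c' : μ → ℝ) :
    blockVec a b c - blockVec a' b' c' = blockVec (a - a') (b - b') (c - c') :=
  blockVec_ext (fun _ => rfl) (fun _ => rfl) fun _ => rfl

lemma blockVec_zero : blockVec (0 : α → ℝ) 0 (0 : μ → ℝ) = 0 :=
  blockVec_ext (fun _ => rfl) (fun _ => rfl) fun _ => rfl

end BlockVec

namespace MixedEnsemble

variable {n m : ℕ} (E : MixedEnsemble n m) (D : Weighting n m)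

/-! ### The system matrices on block vectors -/

lemma To_mulVec_blockVec (p f : Clock n m → ℝ) (z : Fin m → ℝ) :
    E.To *ᵥ blockVec p f z = blockVec (E.V *ᵥ p) (E.V *ᵥ f) z := by
  apply blockVec_ext <;> intro i <;>
    simp [To, mulVec, dotProduct, Fintype.sum_prod_type, one_apply]

lemma To_transpose_mulVec_blockVec (a b : Meas n m → ℝ) (c : Fin m → ℝ) :
    E.Toᵀ *ᵥ blockVec a b c = blockVec (E.Vᵀ *ᵥ a) (E.Vᵀ *ᵥ b) c := by
  apply blockVec_ext <;> intro i <;>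
    simp [To, mulVec, dotProduct, Fintype.sum_prod_type, one_apply]

lemma Aoo_mulVec_blockVec (a b : Meas n m → ℝ) (c : Fin m → ℝ) :
    E.Aoo *ᵥ blockVec a b c =
      blockVec (a + E.τ • b + (E.τ ^ 2 / 2) • (E.V * matJ n m) *ᵥ c)
        (b + E.τ • (E.V * matJ n m) *ᵥ c) c := by
  apply blockVec_ext <;> intro i <;>
    simp [Aoo, matA, vecBeta, colKron, mulVec, dotProduct, Fintype.sum_prod_type, Fin.sum_univ_two,
      one_apply, Finset.mul_sum, mul_assoc]

lemma Aoo_transpose_mulVec_blockVec (a b : Meas n m → ℝ) (c : Fin m → ℝ) :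
    E.Aooᵀ *ᵥ blockVec a b c =
      blockVec a (E.τ • a + b)
        ((E.τ ^ 2 / 2) • (E.V * matJ n m)ᵀ *ᵥ a + E.τ • (E.V * matJ n m)ᵀ *ᵥ b + c) := by
  apply blockVec_ext <;> intro i <;>
    simp [Aoo, matA, vecBeta, colKron, mulVec, dotProduct, Fintype.sum_prod_type, Fin.sum_univ_two,
      one_apply, Finset.mul_sum, mul_assoc, -transpose_mul]

lemma Co_mulVec_blockVec (a b : Meas n m → ℝ) (c : Fin m → ℝ) :
    E.Co *ᵥ blockVec a b c = a := by
  ext i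
  simp [Co, rowKron, vecC, mulVec, dotProduct, Fintype.sum_prod_type, Fin.sum_univ_two, one_apply]

lemma Co_transpose_mulVec (u : Meas n m → ℝ) : E.Coᵀ *ᵥ u = blockVec u 0 0 := by
  apply blockVec_ext <;> intro i <;>
    simp [Co, rowKron, vecC, mulVec, dotProduct, one_apply]

lemma Bo_mulVec (u : Clock n m → ℝ) :
    E.Bo *ᵥ u = blockVec (E.τ • E.V *ᵥ u) (E.V *ᵥ u) 0 := by
  apply blockVec_ext <;> intro i <;>
    simp [Bo, colKron, vecB, mulVec, dotProduct, Finset.mul_sum, mul_add, mul_assoc]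

lemma stateMat_mulVec_blockVec (p f : Clock n m → ℝ) (z : Fin m → ℝ) :
    E.stateMat *ᵥ blockVec p f z =
      blockVec (p + E.τ • f + (E.τ ^ 2 / 2) • matJ n m *ᵥ z) (f + E.τ • matJ n m *ᵥ z) z := by
  apply blockVec_ext <;> intro i <;>
    simp [stateMat, matA, vecBeta, colKron, mulVec, dotProduct, Fintype.sum_prod_type,
      Fin.sum_univ_two, one_apply, Finset.mul_sum, mul_assoc]

lemma inputMat_mulVec (u : Clock n m → ℝ) :
    E.inputMat *ᵥ u = blockVec (E.τ • u) u 0 := by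
  apply blockVec_ext <;> intro i <;>
    simp [inputMat, colKron, vecB, mulVec, dotProduct, one_apply, -Fintype.sum_sum_type]

lemma outputMat_mulVec_blockVec (p f : Clock n m → ℝ) (z : Fin m → ℝ) :
    E.outputMat *ᵥ blockVec p f z = E.V *ᵥ p := by
  ext i
  simp [outputMat, rowKron, vecC, mulVec, dotProduct, Fintype.sum_prod_type, Fin.sum_univ_two]

/-! ### Nondegeneracy of the process noise -/

lemma Q_mulVec_blockVec (p f : Clock n m → ℝ) (z : Fin m → ℝ) :
    E.Q *ᵥ blockVec p f z = blockVec
      (fun i => E.τ * E.σ₁ i ^ 2 * p i + E.σ₂ i ^ 2 * (E.τ ^ 3 / 3 * p i + E.τ ^ 2 / 2 * f i)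
        + Sum.elim (fun _ => 0) (fun j => E.σ₃ j ^ 2 * (E.τ ^ 5 / 20 * p (Sum.inr j)
          + E.τ ^ 4 / 8 * f (Sum.inr j) + E.τ ^ 3 / 6 * z j)) i)
      (fun i => E.σ₂ i ^ 2 * (E.τ ^ 2 / 2 * p i + E.τ * f i)
        + Sum.elim (fun _ => 0) (fun j => E.σ₃ j ^ 2 * (E.τ ^ 4 / 8 * p (Sum.inr j)
          + E.τ ^ 3 / 3 * f (Sum.inr j) + E.τ ^ 2 / 2 * z j)) i)
      (fun j => E.σ₃ j ^ 2 * (E.τ ^ 3 / 6 * p (Sum.inr j)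
          + E.τ ^ 2 / 2 * f (Sum.inr j) + E.τ * z j)) := by
  apply blockVec_ext
  · rintro (i | i) <;>
    simp [Q, Qxx, Qxz, Sigma₁, Sigma₂, Sigma₃, Sigma₄, Sigma₅, colKron, mulVec, dotProduct,
      Fintype.sum_prod_type, Fin.sum_univ_two, diagonal_apply, add_mul, Finset.sum_add_distrib] <;>
    ring
  · rintro (i | i) <;>
    simp [Q, Qxx, Qxz, Sigma₁, Sigma₂, Sigma₃, Sigma₄, Sigma₅, colKron, mulVec, dotProduct,
      Fintype.sum_prod_type, Fin.sum_univ_two, diagonal_apply, add_mul, Finset.sum_add_distrib] <;>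
    ring
  · intro i
    simp [Q, Qxz, Sigma₄, Sigma₅, colKron, mulVec, dotProduct, Fintype.sum_prod_type,
      Fin.sum_univ_two, diagonal_apply]
    ring

lemma Q_transpose : E.Qᵀ = E.Q := by
  have h : E.Qxxᵀ = E.Qxx := by
    ext ⟨s, i⟩ ⟨t, j⟩
    rcases eq_or_ne i j with rfl | hij
    · fin_cases s <;> fin_cases t <;> simp [Qxx]
    · simp [Qxx, Sigma₁, Sigma₂, Sigma₃, hij, hij.symm]
  simp [Q, fromBlocks_transpose, h, Sigma₅]

/-- The variance of a linear functional of the process noise, as a sum of squares: for each clock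
the white, once integrated and twice integrated noises are decorrelated by eliminating first the
drift, then the frequency. -/
lemma quadForm_Q (p f : Clock n m → ℝ) (z : Fin m → ℝ) :
    E.Q.quadForm (blockVec p f z) =
      ∑ i, (E.τ * (E.σ₁ i * p i) ^ 2
        + E.σ₂ i ^ 2 * (E.τ * (f i + E.τ / 2 * p i) ^ 2 + E.τ ^ 3 / 12 * p i ^ 2))
      + ∑ j, E.σ₃ j ^ 2 *
        (E.τ * (z j + E.τ / 2 * f (Sum.inr j) + E.τ ^ 2 / 6 * p (Sum.inr j)) ^ 2
        + E.τ ^ 3 / 12 * (f (Sum.inr j) + E.τ / 2 * p (Sum.inr j)) ^ 2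
        + E.τ ^ 5 / 720 * p (Sum.inr j) ^ 2) := by
  rw [quadForm, Q_mulVec_blockVec]
  simp only [dotProduct, Fintype.sum_sum_type, Fintype.sum_prod_type, Fin.sum_univ_two,
    blockVec_phase, blockVec_freq, blockVec_drift, Sum.elim_inl, Sum.elim_inr, add_zero]
  have hsum : ∀ {A A' C : Fin n → ℝ} {B B' F G G' : Fin m → ℝ}, (∀ i, A i + C i = A' i) →
      (∀ j, B j + F j + G j = B' j + G' j) →
      ∑ i, A i + ∑ j, B j + (∑ i, C i + ∑ j, F j) + ∑ j, G j
        = ∑ i, A' i + ∑ j, B' j + ∑ j, G' j := by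
    intro A A' C B B' F G G' h1 h2
    have h3 := Finset.sum_congr rfl fun i (_ : i ∈ Finset.univ) => h1 i
    have h4 := Finset.sum_congr rfl fun i (_ : i ∈ Finset.univ) => h2 i
    simp only [Finset.sum_add_distrib] at h3 h4
    linarith
  exact hsum (fun i => by ring) fun j => by ring

/-- The process noise is nondegenerate: a Cs-type clock has `σ₂ > 0`, which makes its form in
`(p, f)` definite, and an Hm-type clock has `σ₃ > 0`, which makes its form in `(p, f, z)`
definite. -/
lemma posDef_Q : E.Q.PosDef := by
  have hτ := E.τ_pos
  refine .of_dotProduct_mulVec_pos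
    (by simpa [IsHermitian, conjTranspose_eq_transpose_of_trivial] using E.Q_transpose)
    fun x hx => ?_
  obtain ⟨p, f, z, rfl⟩ := exists_eq_blockVec x
  rw [star_trivial]
  change 0 < E.Q.quadForm _
  rw [quadForm_Q]
  have h1 : ∀ i, 0 ≤ E.τ * (E.σ₁ i * p i) ^ 2
        + E.σ₂ i ^ 2 * (E.τ * (f i + E.τ / 2 * p i) ^ 2 + E.τ ^ 3 / 12 * p i ^ 2) := fun i => by
    positivity
  have h2 : ∀ j, 0 ≤ E.σ₃ j ^ 2 *
        (E.τ * (z j + E.τ / 2 * f (Sum.inr j) + E.τ ^ 2 / 6 * p (Sum.inr j)) ^ 2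
        + E.τ ^ 3 / 12 * (f (Sum.inr j) + E.τ / 2 * p (Sum.inr j)) ^ 2
        + E.τ ^ 5 / 720 * p (Sum.inr j) ^ 2) := fun j => by positivity
  refine lt_of_le_of_ne
    (add_nonneg (Finset.sum_nonneg fun i _ => h1 i) (Finset.sum_nonneg fun j _ => h2 j))
    fun h0 => hx ?_
  obtain ⟨h3, h4⟩ := (add_eq_zero_iff_of_nonneg (Finset.sum_nonneg fun i _ => h1 i)
    (Finset.sum_nonneg fun j _ => h2 j)).1 h0.symm
  rw [Finset.sum_eq_zero_iff_of_nonneg fun i _ => h1 i] at h3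
  rw [Finset.sum_eq_zero_iff_of_nonneg fun i _ => h2 i] at h4
  have hcs : ∀ i : Fin n, p (Sum.inl i) = 0 ∧ f (Sum.inl i) = 0 := fun i => by
    have h := h3 (Sum.inl i) (Finset.mem_univ _)
    have hσ := E.σ₂_pos i
    replace h := ((add_eq_zero_iff_of_nonneg (by positivity) (by positivity)).1 h).2
    replace h := (mul_eq_zero.1 h).resolve_left (by positivity)
    rw [add_eq_zero_iff_of_nonneg (by positivity) (by positivity)] at h
    have hp : p (Sum.inl i) = 0 := by simpa [hτ.ne'] using h.2
    exact ⟨hp, by simpa [hτ.ne', hp] using h.1⟩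
  have hhm : ∀ j : Fin m, p (Sum.inr j) = 0 ∧ f (Sum.inr j) = 0 ∧ z j = 0 := fun j => by
    have h := h4 j (Finset.mem_univ _)
    have hσ := E.σ₃_pos j
    replace h := (mul_eq_zero.1 h).resolve_left (by positivity)
    rw [add_eq_zero_iff_of_nonneg (by positivity) (by positivity),
      add_eq_zero_iff_of_nonneg (by positivity) (by positivity)] at h
    have hp : p (Sum.inr j) = 0 := by simpa [hτ.ne'] using h.2
    have hf : f (Sum.inr j) = 0 := by simpa [hτ.ne', hp] using h.1.2
    exact ⟨hp, hf, by simpa [hτ.ne', hp, hf] using h.1.1⟩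
  rw [← blockVec_zero]
  congr 1
  · ext (i | j)
    exacts [(hcs i).1, (hhm j).1]
  · ext (i | j)
    exacts [(hcs i).2, (hhm j).2.1]
  · ext j
    exact (hhm j).2.2

/-! ### The generalized inverse of `V` -/

lemma mulVec_W_eq_zero {x : Meas n m → ℝ} (hx : D.W *ᵥ x = 0) : x = 0 := by
  have h := LinearMap.finrank_range_add_finrank_ker D.W.mulVecLin
  rw [show Module.finrank ℝ (LinearMap.range D.W.mulVecLin) = n + m - 1 from D.rank_W] at h
  have hk : Module.finrank ℝ (LinearMap.ker D.W.mulVecLin) = 0 := by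
    rw [Module.finrank_pi, Fintype.card_fin] at h
    omega
  rw [Submodule.finrank_eq_zero, LinearMap.ker_eq_bot'] at hk
  exact hk x hx

lemma isUnit_V_mul_W : IsUnit (E.V * D.W) := by
  rw [← mulVec_injective_iff_isUnit]
  refine (injective_iff_map_eq_zero (E.V * D.W).mulVecLin).2 fun x hx => ?_
  rw [mulVecLin_apply, ← mulVec_mulVec, E.ker_V] at hx
  obtain ⟨c, hc⟩ := hx
  have h : D.q ⬝ᵥ D.W *ᵥ x = 0 := by rw [dotProduct_mulVec, D.q_W, zero_dotProduct]
  rw [hc, dotProduct, ← Finset.sum_mul, D.sum_q, one_mul] at h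
  exact mulVec_W_eq_zero D (hc.trans (by rw [h]; rfl))

lemma V_mul_Vplus : E.V * E.Vplus D = 1 := by
  rw [Vplus, ← Matrix.mul_assoc,
    mul_nonsing_inv _ ((isUnit_iff_isUnit_det _).1 (E.isUnit_V_mul_W D))]

lemma V_mulVec_Vplus_mulVec (x : Meas n m → ℝ) : E.V *ᵥ E.Vplus D *ᵥ x = x := by
  rw [mulVec_mulVec, V_mul_Vplus, one_mulVec]

lemma q_dotProduct_Vplus_mulVec (x : Meas n m → ℝ) : D.q ⬝ᵥ E.Vplus D *ᵥ x = 0 := by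
  rw [Vplus, ← mulVec_mulVec, dotProduct_mulVec, D.q_W, zero_dotProduct]

/-- `V` has full row rank, having the right inverse `V⁺` for any weighting `D`. -/
lemma V_transpose_mulVec_eq_zero (D : Weighting n m) {x : Meas n m → ℝ} (hx : E.Vᵀ *ᵥ x = 0) :
    x = 0 := by
  have h := congrArg (fun y => (E.Vplus D)ᵀ *ᵥ y) hx
  simpa [mulVec_mulVec, ← transpose_mul, V_mul_Vplus E D] using h

/-- The synchronization error is the image under `V⁺` of the clock differences, since
`V⁺ V = I - 1 qᵀ`. -/
lemma syncError_blockVec (p f : Clock n m → ℝ) (z : Fin m → ℝ) :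
    E.syncError D (blockVec p f z) = E.Vplus D *ᵥ E.V *ᵥ p := by
  obtain ⟨c, hc⟩ := (E.ker_V (p - E.Vplus D *ᵥ E.V *ᵥ p)).1
    (by rw [mulVec_sub, V_mulVec_Vplus_mulVec, sub_self])
  have h : D.q ⬝ᵥ p = c := by
    have := congrArg (fun y => D.q ⬝ᵥ y) hc
    simp only [dotProduct_sub, q_dotProduct_Vplus_mulVec, sub_zero] at this
    rw [this, dotProduct, ← Finset.sum_mul, D.sum_q, one_mul]
  ext i
  have hi := congrFun hc i
  have hu : vecC ⬝ᵥ unobs D (blockVec p f z) = D.q ⬝ᵥ p := by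
    simp [vecC, unobs, dotProduct]
  rw [syncError, hu, h, blockVec_phase]
  simp only [Pi.sub_apply] at hi
  linarith

/-! ### Solvability of the Riccati equation -/

/-- The process noise of the observable state is nondegenerate as well, since `V` has full row
rank. -/
lemma posDef_obsNoise (D : Weighting n m) : (E.To * E.Q * E.Toᵀ).PosDef := by
  have h := E.posDef_Q.mul_mul_conjTranspose_same (B := E.To) ?_
  · rwa [conjTranspose_eq_transpose_of_trivial] at h
  refine (injective_iff_map_eq_zero E.To.vecMulLinear).2 fun x hx => ?_
  obtain ⟨a, b, c, rfl⟩ := exists_eq_blockVec x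
  rw [vecMulLinear_apply, ← mulVec_transpose, To_transpose_mulVec_blockVec] at hx
  have ha : a = 0 := E.V_transpose_mulVec_eq_zero D
    (funext fun i => by simpa using congrFun hx (Sum.inl (0, i)))
  have hb : b = 0 := E.V_transpose_mulVec_eq_zero D
    (funext fun i => by simpa using congrFun hx (Sum.inl (1, i)))
  have hc : c = 0 := funext fun j => by simpa using congrFun hx (Sum.inr j)
  rw [ha, hb, hc, blockVec_zero]

/-- `V J` is injective, hence `(V J)ᵀ` is surjective: a vector `J z` with equal entries vanishes,
because its entries at the Cs-type clocks do. -/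
lemma exists_transpose_mulVec_eq (c : Fin m → ℝ) : ∃ a, (E.V * matJ n m)ᵀ *ᵥ a = c := by
  have hinj : Function.Injective (E.V * matJ n m).mulVec := by
    refine (injective_iff_map_eq_zero (E.V * matJ n m).mulVecLin).2 fun x hx => ?_
    rw [mulVecLin_apply, ← mulVec_mulVec, E.ker_V] at hx
    obtain ⟨d, hd⟩ := hx
    have h0 := congrFun hd (Sum.inl ⟨0, E.n_pos⟩)
    ext j
    have h1 := congrFun hd (Sum.inr j)
    simp [matJ, fromRows_mulVec] at h0 h1
    rw [h1, ← h0]; rfl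
  have hpd := PosDef.conjTranspose_mul_self (E.V * matJ n m) hinj
  rw [conjTranspose_eq_transpose_of_trivial] at hpd
  refine ⟨(E.V * matJ n m) *ᵥ ((E.V * matJ n m)ᵀ * (E.V * matJ n m))⁻¹ *ᵥ c, ?_⟩
  rw [mulVec_mulVec, mulVec_mulVec, mul_nonsing_inv _ ((isUnit_iff_isUnit_det _).1 hpd.isUnit),
    one_mulVec]

/-- Three inputs steer the dual system of the observable state to zero, which is observability in
dual form. The inputs are parametrized by the phase parts `a₁`, `a₂`, `0` that they produce. -/
lemma steerable (x : ObsIdx n m → ℝ) : Steerable E.Aoo E.Co 3 x := by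
  have hτ := E.τ_pos.ne'
  have hstep : ∀ (a b : Meas n m → ℝ) (c : Fin m → ℝ) (a' : Meas n m → ℝ),
      E.Aooᵀ *ᵥ blockVec a b c - E.Coᵀ *ᵥ (a - a') = blockVec a' (E.τ • a + b)
        ((E.τ ^ 2 / 2) • (E.V * matJ n m)ᵀ *ᵥ a + E.τ • (E.V * matJ n m)ᵀ *ᵥ b + c) := by
    intro a b c a'
    rw [Aoo_transpose_mulVec_blockVec, Co_transpose_mulVec, blockVec_sub, sub_sub_cancel, sub_zero,
      sub_zero]
  obtain ⟨a₀, b₀, c₀, rfl⟩ := exists_eq_blockVec x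
  set H := (E.V * matJ n m)ᵀ
  set b₁ := E.τ • a₀ + b₀ with hb₁
  set c₁ := (E.τ ^ 2 / 2) • H *ᵥ a₀ + E.τ • H *ᵥ b₀ + c₀ with hc₁
  -- `a₁ + a₂ = -b₁ / τ` makes the final frequency part vanish; with it, the final drift part is
  -- `c₁ + (3 τ / 2) H b₁ + τ² H a₁`
  obtain ⟨a₁, ha₁⟩ : ∃ a₁, H *ᵥ a₁ = _ := E.exists_transpose_mulVec_eq
    (-(1 / E.τ ^ 2) • (c₁ + (3 / 2 * E.τ) • H *ᵥ b₁))
  set a₂ := -a₁ - (1 / E.τ) • b₁ with ha₂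
  refine ⟨a₀ - a₁, a₁ - a₂, a₂ - 0, ?_⟩
  change _ = 0
  rw [hstep, hstep, hstep, ← blockVec_zero]
  congr 1
  · rw [← hb₁, ha₂]
    ext i
    simp
    field_simp
    ring
  · rw [← hb₁, ← hc₁, ha₂]
    simp only [mulVec_sub, mulVec_neg, mulVec_add, mulVec_smul, ha₁]
    ext i
    simp
    field_simp
    ring

/-! ### Closed-loop identities -/

/-- The feedback matrix `[F ⊗ I, (τ/2) V J]` with `F = [γ/τ, 1]`, so that `φ = -feedback η̂`. -/
def feedback (γ : ℝ) : Matrix (Meas n m) (ObsIdx n m) ℝ :=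
  Matrix.fromCols (rowKron ![γ / E.τ, 1] (1 : Matrix (Meas n m) (Meas n m) ℝ))
    ((E.τ / 2) • (E.V * matJ n m))

lemma control_eq (γ : ℝ) (x : ObsIdx n m → ℝ) :
    E.control D ![γ / E.τ, 1] (E.τ / 2) x = E.Vplus D *ᵥ (-(E.feedback γ *ᵥ x)) := rfl

lemma feedback_mulVec_blockVec (γ : ℝ) (a b : Meas n m → ℝ) (c : Fin m → ℝ) :
    E.feedback γ *ᵥ blockVec a b c =
      (γ / E.τ) • a + b + (E.τ / 2) • (E.V * matJ n m) *ᵥ c := by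
  ext i
  simp [feedback, rowKron, mulVec, dotProduct, Fintype.sum_prod_type, Fin.sum_univ_two,
      one_apply, Finset.mul_sum, mul_assoc]

lemma To_mulVec_stateMat_mulVec (s : StateIdx n m → ℝ) :
    E.To *ᵥ E.stateMat *ᵥ s = E.Aoo *ᵥ E.To *ᵥ s := by
  obtain ⟨p, f, z, rfl⟩ := exists_eq_blockVec s
  simp only [stateMat_mulVec_blockVec, To_mulVec_blockVec, Aoo_mulVec_blockVec, mulVec_add,
    mulVec_smul, mulVec_mulVec]

lemma To_mulVec_inputMat_mulVec (u : Clock n m → ℝ) :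
    E.To *ᵥ E.inputMat *ᵥ u = E.Bo *ᵥ u := by
  rw [inputMat_mulVec, To_mulVec_blockVec, Bo_mulVec, mulVec_smul]

lemma outputMat_mulVec (s : StateIdx n m → ℝ) : E.outputMat *ᵥ s = E.Co *ᵥ E.To *ᵥ s := by
  obtain ⟨p, f, z, rfl⟩ := exists_eq_blockVec s
  rw [outputMat_mulVec_blockVec, To_mulVec_blockVec, Co_mulVec_blockVec]

lemma syncError_eq (s : StateIdx n m → ℝ) :
    E.syncError D s = E.Vplus D *ᵥ E.Co *ᵥ E.To *ᵥ s := by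
  obtain ⟨p, f, z, rfl⟩ := exists_eq_blockVec s
  rw [syncError_blockVec, To_mulVec_blockVec, Co_mulVec_blockVec]

/-- The gains `F` and `τ/2` are such that the control, fed with the true observable state, would
multiply the clock differences by `1 - γ` in each step. -/
lemma Co_mulVec_Aoo_mulVec (γ : ℝ) (x : ObsIdx n m → ℝ) :
    E.Co *ᵥ E.Aoo *ᵥ x = (1 - γ) • E.Co *ᵥ x + E.τ • E.feedback γ *ᵥ x := by
  have hτ := E.τ_pos.ne'
  obtain ⟨a, b, c, rfl⟩ := exists_eq_blockVec x
  rw [Aoo_mulVec_blockVec, Co_mulVec_blockVec, Co_mulVec_blockVec, feedback_mulVec_blockVec]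
  ext i
  simp
  field_simp
  ring

lemma Co_mulVec_Bo_mulVec_control (γ : ℝ) (x : ObsIdx n m → ℝ) :
    E.Co *ᵥ E.Bo *ᵥ E.control D ![γ / E.τ, 1] (E.τ / 2) x = -(E.τ • E.feedback γ *ᵥ x) := by
  rw [Bo_mulVec, Co_mulVec_blockVec, control_eq, V_mulVec_Vplus_mulVec, smul_neg]

lemma unobs_add (s t : StateIdx n m → ℝ) : unobs D (s + t) = unobs D s + unobs D t := by
  ext a
  simp only [unobs, Pi.add_apply, mul_add, Finset.sum_add_distrib]

lemma unobs_blockVec (p f : Clock n m → ℝ) (z : Fin m → ℝ) :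
    unobs D (blockVec p f z) = ![D.q ⬝ᵥ p, D.q ⬝ᵥ f] := by
  ext a
  fin_cases a <;> rfl

lemma unobs_stateMat_mulVec (s : StateIdx n m → ℝ) :
    unobs D (E.stateMat *ᵥ s) =
      matA E.τ *ᵥ unobs D s + (D.q ⬝ᵥ (matJ n m *ᵥ drift s)) • vecBeta E.τ := by
  obtain ⟨p, f, z, rfl⟩ := exists_eq_blockVec s
  have hz : drift (blockVec p f z) = z := rfl
  rw [stateMat_mulVec_blockVec, unobs_blockVec, unobs_blockVec, hz]
  ext a
  fin_cases a <;>
    simp [matA, vecBeta, dotProduct_add, dotProduct_smul, mul_comm, -Fintype.sum_sum_type]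

/-- The control does not act on the unobservable state, since `qᵀ V⁺ = 0`. -/
lemma unobs_inputMat_mulVec_control (γ : ℝ) (x : ObsIdx n m → ℝ) :
    unobs D (E.inputMat *ᵥ E.control D ![γ / E.τ, 1] (E.τ / 2) x) = 0 := by
  rw [inputMat_mulVec, unobs_blockVec, dotProduct_smul, control_eq, q_dotProduct_Vplus_mulVec]
  ext a
  fin_cases a <;> simp

/-! ### The closed loop as a stochastic process -/

section ClosedLoop

variable {Ω : Type*} (γ : ℝ) (R : Matrix (ObsIdx n m) (ObsIdx n m) ℝ)
  (v : ℕ → Ω → StateIdx n m → ℝ) (w : ℕ → Ω → Meas n m → ℝ)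
  (s₀ : Ω → StateIdx n m → ℝ) (x₀ : Ω → ObsIdx n m → ℝ) (k : ℕ) (ω : Ω)

/-- The filter estimate of the observable state as a stochastic process. -/
def estimate : ObsIdx n m → ℝ :=
  (E.closedLoop D ![γ / E.τ, 1] (E.τ / 2) (E.gain R) (fun l => v l ω) (fun l => w l ω)
    (s₀ ω) (x₀ ω) k).2

/-- The estimation error of the observable state. -/
def estError : ObsIdx n m → ℝ :=
  E.To *ᵥ E.state D γ R v w s₀ x₀ k ω - E.estimate D γ R v w s₀ x₀ k ω

/-- The clock differences `V p`, as the phase part of the observable state. -/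
def clockDiff : Meas n m → ℝ :=
  E.Co *ᵥ E.To *ᵥ E.state D γ R v w s₀ x₀ k ω

lemma state_succ : E.state D γ R v w s₀ x₀ (k + 1) ω =
    E.stateMat *ᵥ E.state D γ R v w s₀ x₀ k ω
      + E.inputMat *ᵥ E.control D ![γ / E.τ, 1] (E.τ / 2) (E.estimate D γ R v w s₀ x₀ k ω)
      + v k ω := rfl

lemma estimate_succ : E.estimate D γ R v w s₀ x₀ (k + 1) ω =
    E.Aoo *ᵥ E.estimate D γ R v w s₀ x₀ k ω
      + E.Bo *ᵥ E.control D ![γ / E.τ, 1] (E.τ / 2) (E.estimate D γ R v w s₀ x₀ k ω)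
      + E.gain R *ᵥ (E.outputMat *ᵥ E.state D γ R v w s₀ x₀ (k + 1) ω + w (k + 1) ω
        - E.Co *ᵥ (E.Aoo *ᵥ E.estimate D γ R v w s₀ x₀ k ω
          + E.Bo *ᵥ E.control D ![γ / E.τ, 1] (E.τ / 2) (E.estimate D γ R v w s₀ x₀ k ω))) :=
  rfl

/-- Separation principle: the control cancels from the estimation error. -/
lemma estError_succ : E.estError D γ R v w s₀ x₀ (k + 1) ω =
    ((1 - E.gain R * E.Co) * E.Aoo) *ᵥ E.estError D γ R v w s₀ x₀ k ω
      + ((1 - E.gain R * E.Co) * E.To) *ᵥ v k ω - E.gain R *ᵥ w (k + 1) ω := by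
  rw [estError, estError, estimate_succ, outputMat_mulVec, state_succ]
  simp only [mulVec_add, mulVec_sub, To_mulVec_stateMat_mulVec, To_mulVec_inputMat_mulVec,
    ← mulVec_mulVec, sub_mulVec, one_mulVec]
  abel

/-- The clock differences obey a scalar recursion driven by the estimation error. -/
lemma clockDiff_succ : E.clockDiff D γ R v w s₀ x₀ (k + 1) ω =
    (1 - γ) • E.clockDiff D γ R v w s₀ x₀ k ω
      + E.τ • E.feedback γ *ᵥ E.estError D γ R v w s₀ x₀ k ω + (E.Co * E.To) *ᵥ v k ω := by
  rw [clockDiff, clockDiff, estError, state_succ, mulVec_add, mulVec_add, mulVec_add, mulVec_add,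
    To_mulVec_stateMat_mulVec, To_mulVec_inputMat_mulVec, E.Co_mulVec_Aoo_mulVec γ,
    Co_mulVec_Bo_mulVec_control, mulVec_sub, smul_sub, ← mulVec_mulVec]
  abel

lemma unobs_state_succ : unobs D (E.state D γ R v w s₀ x₀ (k + 1) ω) =
    matA E.τ *ᵥ unobs D (E.state D γ R v w s₀ x₀ k ω)
      + (D.q ⬝ᵥ (matJ n m *ᵥ drift (E.state D γ R v w s₀ x₀ k ω))) • vecBeta E.τ
      + unobs D (v k ω) := by
  rw [state_succ, unobs_add, unobs_add, unobs_stateMat_mulVec, unobs_inputMat_mulVec_control,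
    add_zero]

variable [MeasurableSpace Ω] {P : Measure Ω} {v w s₀ x₀}

lemma integrable_state_and_estimate (hv : ∀ k, Integrable (v k) P) (hw : ∀ k, Integrable (w k) P)
    (hs : Integrable s₀ P) (hx : Integrable x₀ P) (k : ℕ) :
    Integrable (E.state D γ R v w s₀ x₀ k) P ∧ Integrable (E.estimate D γ R v w s₀ x₀ k) P := by
  induction k with
  | zero => exact ⟨hs, hx⟩
  | succ k ih =>
    obtain ⟨ihs, ihx⟩ := ih
    have hu : Integrable (fun ω => E.control D ![γ / E.τ, 1] (E.τ / 2)
        (E.estimate D γ R v w s₀ x₀ k ω)) P :=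
      integrable_mulVec _ (integrable_mulVec _ ihx).neg
    have hs' : Integrable (E.state D γ R v w s₀ x₀ (k + 1)) P :=
      ((integrable_mulVec _ ihs).add (integrable_mulVec _ hu)).add (hv k)
    have hp := (integrable_mulVec E.Aoo ihx).add (integrable_mulVec E.Bo hu)
    exact ⟨hs', hp.add (integrable_mulVec _
      (((integrable_mulVec _ hs').add (hw (k + 1))).sub (integrable_mulVec _ hp)))⟩

variable (hv : IsWhiteGaussian v E.Q P) (hw : IsWhiteGaussian w (E.r • 1) P)
  (hs : Integrable s₀ P) (hx : Integrable x₀ P)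

include hv hw hs hx

lemma integrable_state : Integrable (E.state D γ R v w s₀ x₀ k) P :=
  (E.integrable_state_and_estimate D γ R hv.integrable hw.integrable hs hx k).1

lemma integrable_estError : Integrable (E.estError D γ R v w s₀ x₀ k) P :=
  (integrable_mulVec _ (E.integrable_state D γ R k hv hw hs hx)).sub
    (E.integrable_state_and_estimate D γ R hv.integrable hw.integrable hs hx k).2

lemma integrable_clockDiff : Integrable (E.clockDiff D γ R v w s₀ x₀ k) P :=
  integrable_mulVec _ (integrable_mulVec _ (E.integrable_state D γ R k hv hw hs hx))

lemma integral_estError : ∫ ω, E.estError D γ R v w s₀ x₀ k ω ∂P =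
    (((1 - E.gain R * E.Co) * E.Aoo) ^ k) *ᵥ ∫ ω, E.estError D γ R v w s₀ x₀ 0 ω ∂P := by
  induction k with
  | zero => simp
  | succ k ih =>
    have he := E.integrable_estError D γ R k hv hw hs hx
    simp only [estError_succ]
    rw [integral_sub ((integrable_mulVec _ he).add (integrable_mulVec _ (hv.integrable k)))
      (integrable_mulVec _ (hw.integrable _)),
      integral_add (integrable_mulVec _ he) (integrable_mulVec _ (hv.integrable k)),
      integral_mulVec _ he, integral_mulVec _ (hv.integrable k),
      integral_mulVec _ (hw.integrable _),
      hv.integral_eq_zero, hw.integral_eq_zero, ih, mulVec_zero, mulVec_zero, add_zero, sub_zero,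
      mulVec_mulVec, pow_succ']

lemma integral_clockDiff_succ : ∫ ω, E.clockDiff D γ R v w s₀ x₀ (k + 1) ω ∂P =
    (1 - γ) • ∫ ω, E.clockDiff D γ R v w s₀ x₀ k ω ∂P
      + E.τ • E.feedback γ *ᵥ ∫ ω, E.estError D γ R v w s₀ x₀ k ω ∂P := by
  have he := E.integrable_estError D γ R k hv hw hs hx
  have hd := E.integrable_clockDiff D γ R k hv hw hs hx
  have h1 : Integrable (fun ω => (1 - γ) • E.clockDiff D γ R v w s₀ x₀ k ω) P := hd.smul (1 - γ)
  have h2 : Integrable (fun ω => E.τ • E.feedback γ *ᵥ E.estError D γ R v w s₀ x₀ k ω) P :=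
    (integrable_mulVec _ he).smul E.τ
  have h3 := integrable_mulVec (E.Co * E.To) (hv.integrable k)
  have h12 : Integrable (fun ω => (1 - γ) • E.clockDiff D γ R v w s₀ x₀ k ω
      + E.τ • E.feedback γ *ᵥ E.estError D γ R v w s₀ x₀ k ω) P := h1.add h2
  simp only [clockDiff_succ]
  rw [integral_add h12 h3, integral_add h1 h2, integral_smul,
    integral_smul, integral_mulVec _ he, integral_mulVec _ (hv.integrable k), hv.integral_eq_zero,
    mulVec_zero, add_zero]

lemma integrable_syncError :
    Integrable (fun ω => E.syncError D (E.state D γ R v w s₀ x₀ k ω)) P := by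
  simp only [syncError_eq]
  exact integrable_mulVec _ (E.integrable_clockDiff D γ R k hv hw hs hx)

lemma integral_syncError : ∫ ω, E.syncError D (E.state D γ R v w s₀ x₀ k ω) ∂P =
    E.Vplus D *ᵥ ∫ ω, E.clockDiff D γ R v w s₀ x₀ k ω ∂P := by
  simp only [syncError_eq]
  exact integral_mulVec _ (E.integrable_clockDiff D γ R k hv hw hs hx)

/-- Synchronization in the mean amounts to the decay of the expected clock differences. -/
lemma tendsto_integral_syncError_iff :
    Tendsto (fun k => ∫ ω, E.syncError D (E.state D γ R v w s₀ x₀ k ω) ∂P) atTop (𝓝 0) ↔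
      Tendsto (fun k => ∫ ω, E.clockDiff D γ R v w s₀ x₀ k ω ∂P) atTop (𝓝 0) := by
  simp only [E.integral_syncError D γ R _ hv hw hs hx]
  have hlim : ∀ {ι κ : Type} [Fintype ι] [Fintype κ] (M : Matrix κ ι ℝ) {a : ℕ → ι → ℝ},
      Tendsto a atTop (𝓝 0) → Tendsto (fun k => M *ᵥ a k) atTop (𝓝 0) := by
    intro ι κ _ _ M a ha
    have h : Continuous fun x => M *ᵥ x := continuous_const.matrix_mulVec continuous_id
    simpa [Function.comp_def] using (h.tendsto 0).comp ha
  refine ⟨fun h => ?_, fun h => hlim _ h⟩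
  simpa only [V_mulVec_Vplus_mulVec] using hlim E.V h

/-- From an unbiased estimate and expected clock differences that are not all zero, the expected
clock differences form a nonzero geometric sequence. -/
lemma tendsto_integral_clockDiff_iff_of_unbiased
    (h0 : ∫ ω, E.estError D γ R v w s₀ x₀ 0 ω ∂P = 0)
    (hne : ∫ ω, E.clockDiff D γ R v w s₀ x₀ 0 ω ∂P ≠ 0) :
    Tendsto (fun k => ∫ ω, E.clockDiff D γ R v w s₀ x₀ k ω ∂P) atTop (𝓝 0) ↔ |1 - γ| < 1 := by
  have hgeom : ∀ k, ∫ ω, E.clockDiff D γ R v w s₀ x₀ k ω ∂P =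
      (1 - γ) ^ k • ∫ ω, E.clockDiff D γ R v w s₀ x₀ 0 ω ∂P := by
    intro k
    induction k with
    | zero => simp
    | succ k ih =>
      rw [E.integral_clockDiff_succ D γ R k hv hw hs hx, E.integral_estError D γ R k hv hw hs hx,
        h0, mulVec_zero, mulVec_zero, smul_zero, add_zero, ih, smul_smul, pow_succ']
  rw [← tendsto_pow_atTop_nhds_zero_iff, tendsto_congr hgeom]
  refine ⟨fun h => ?_, fun h => by
    simpa using h.smul_const (∫ ω, E.clockDiff D γ R v w s₀ x₀ 0 ω ∂P)⟩
  obtain ⟨i, hi⟩ := Function.ne_iff.1 hne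
  have h' := (tendsto_pi_nhds.1 h i).div_const ((∫ ω, E.clockDiff D γ R v w s₀ x₀ 0 ω ∂P) i)
  simp only [Pi.zero_apply, zero_div, Pi.smul_apply, smul_eq_mul] at h' hi
  exact h'.congr fun k => mul_div_cancel_right₀ _ hi

/-- The expected estimation error tends to zero and drives a contraction. -/
lemma tendsto_integral_clockDiff (hγ : |1 - γ| < 1)
    (hstab : Tendsto (fun k : ℕ => ((1 - E.gain R * E.Co) * E.Aoo) ^ k) atTop (𝓝 0)) :
    Tendsto (fun k => ∫ ω, E.clockDiff D γ R v w s₀ x₀ k ω ∂P) atTop (𝓝 0) := by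
  refine tendsto_zero_of_recursion hγ
    (fun k => E.integral_clockDiff_succ D γ R k hv hw hs hx) ?_
  have h : Continuous fun X : Matrix (ObsIdx n m) (ObsIdx n m) ℝ =>
      E.τ • E.feedback γ *ᵥ X *ᵥ ∫ ω, E.estError D γ R v w s₀ x₀ 0 ω ∂P :=
    (continuous_const.matrix_mulVec
      (continuous_id.matrix_mulVec continuous_const)).const_smul E.τ
  have hlim := (h.tendsto 0).comp hstab
  rw [zero_mulVec, mulVec_zero, smul_zero] at hlim
  exact hlim.congr fun k => by rw [E.integral_estError D γ R k hv hw hs hx]; rfl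

lemma tendsto_integral_syncError_iff_of_unbiased
    (h0 : ∫ ω, x₀ ω ∂P = ∫ ω, E.To *ᵥ s₀ ω ∂P)
    (hne : ∃ i j, ∫ ω, s₀ ω (Sum.inl (0, i)) ∂P ≠ ∫ ω, s₀ ω (Sum.inl (0, j)) ∂P) :
    Tendsto (fun k => ∫ ω, E.syncError D (E.state D γ R v w s₀ x₀ k ω) ∂P) atTop (𝓝 0) ↔
      |1 - γ| < 1 := by
  rw [E.tendsto_integral_syncError_iff D γ R hv hw hs hx]
  refine E.tendsto_integral_clockDiff_iff_of_unbiased D γ R hv hw hs hx ?_ fun h => ?_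
  · change ∫ ω, (E.To *ᵥ s₀ ω - x₀ ω) ∂P = 0
    rw [integral_sub (integrable_mulVec _ hs) hx, h0, sub_self]
  · change ∫ ω, E.Co *ᵥ E.To *ᵥ s₀ ω ∂P = 0 at h
    rw [integral_mulVec _ (integrable_mulVec _ hs), integral_mulVec _ hs] at h
    obtain ⟨p, f, z, hpfz⟩ := exists_eq_blockVec (∫ ω, s₀ ω ∂P)
    rw [hpfz, To_mulVec_blockVec, Co_mulVec_blockVec, E.ker_V] at h
    obtain ⟨c, hc⟩ := h
    have hp : ∀ i, ∫ ω, s₀ ω (Sum.inl (0, i)) ∂P = c := fun i => by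
      rw [← eval_integral fun i => hs.eval i, hpfz, blockVec_phase, hc]
    obtain ⟨i, j, hij⟩ := hne
    exact hij (by rw [hp, hp])

end ClosedLoop

end MixedEnsemble

/-! ### Synchronization of the ensemble -/

theorem theorem2 {n m : ℕ} (E : MixedEnsemble n m) (D : Weighting n m) (γ : ℝ)
    {Ω : Type*} [MeasurableSpace Ω] (P : Measure Ω) [IsProbabilityMeasure P]
    (v : ℕ → Ω → StateIdx n m → ℝ) (hv : IsWhiteGaussian v E.Q P)
    (w : ℕ → Ω → Meas n m → ℝ) (hw : IsWhiteGaussian w (E.r • 1) P) :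
    -- the steady-state error covariance exists and is unique
    ∃ Pstar : Matrix (ObsIdx n m) (ObsIdx n m) ℝ,
      E.IsSteadyStateCov Pstar ∧ (∀ P', E.IsSteadyStateCov P' → P' = Pstar) ∧
      -- dynamics of the synchronization destination
      (∀ s₀ ηhat₀ k ω,
        MixedEnsemble.unobs D (E.state D γ Pstar v w s₀ ηhat₀ (k + 1) ω) =
          matA E.τ *ᵥ MixedEnsemble.unobs D (E.state D γ Pstar v w s₀ ηhat₀ k ω)
            + (D.q ⬝ᵥ (matJ n m *ᵥ MixedEnsemble.drift (E.state D γ Pstar v w s₀ ηhat₀ k ω)))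
                • vecBeta E.τ
            + MixedEnsemble.unobs D (v k ω)) ∧
      -- the expectations below exist
      (∀ s₀ ηhat₀, Integrable s₀ P → Integrable ηhat₀ P → ∀ k,
        Integrable (fun ω => E.syncError D (E.state D γ Pstar v w s₀ ηhat₀ k ω)) P) ∧
      -- synchronization from all initial conditions if and only if `|1 - γ| < 1`
      ((∀ s₀ ηhat₀, Integrable s₀ P → Integrable ηhat₀ P →
          Tendsto (fun k => ∫ ω, E.syncError D (E.state D γ Pstar v w s₀ ηhat₀ k ω) ∂P)
            atTop (𝓝 0))
        ↔ |1 - γ| < 1) ∧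
      -- the same equivalence for each single initial condition for which the filter is started
      -- without bias and the expected initial phases are not already all equal
      (∀ s₀ ηhat₀, Integrable s₀ P → Integrable ηhat₀ P →
        (∫ ω, ηhat₀ ω ∂P = ∫ ω, E.To *ᵥ s₀ ω ∂P) →
        (∃ i j, ∫ ω, s₀ ω (Sum.inl (0, i)) ∂P ≠ ∫ ω, s₀ ω (Sum.inl (0, j)) ∂P) →
        (Tendsto (fun k => ∫ ω, E.syncError D (E.state D γ Pstar v w s₀ ηhat₀ k ω) ∂P)
            atTop (𝓝 0)
          ↔ |1 - γ| < 1)) := by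
  have hQ := E.posDef_obsNoise D
  obtain ⟨R, hR, huniq⟩ := exists_unique_riccati_eq hQ E.r_pos E.steerable
  have hstab : Tendsto (fun k : ℕ => ((1 - E.gain R * E.Co) * E.Aoo) ^ k) atTop (𝓝 0) :=
    tendsto_pow_filter hQ E.r_pos hR.1 hR.2 (L := E.gain R)
      (by simp only [MixedEnsemble.gain, predictorGain, Matrix.mul_assoc])
  refine ⟨R, hR, huniq, fun s₀ x₀ k ω => E.unobs_state_succ D γ R v w s₀ x₀ k ω,
    fun s₀ x₀ hs hx k => E.integrable_syncError D γ R k hv hw hs hx, ⟨fun h => ?_, ?_⟩,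
    fun s₀ x₀ hs hx h0 hne =>
      E.tendsto_integral_syncError_iff_of_unbiased D γ R hv hw hs hx h0 hne⟩
  · -- start from one clock out of phase and a perfect estimate
    have hs : Integrable
        (fun _ : Ω => blockVec (Sum.elim (fun _ => 1) (fun _ => 0)) 0 0 : Ω → StateIdx n m → ℝ) P :=
      integrable_const _
    refine (E.tendsto_integral_syncError_iff_of_unbiased D γ R hv hw hs
      (integrable_mulVec E.To hs) rfl
      ⟨Sum.inl ⟨0, E.n_pos⟩, Sum.inr ⟨0, E.m_pos⟩, by simp⟩).1
      (h _ _ hs (integrable_mulVec E.To hs))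
  · intro hγ s₀ x₀ hs hx
    rw [E.tendsto_integral_syncError_iff D γ R hv hw hs hx]
    exact E.tendsto_integral_clockDiff D γ R hv hw hs hx hγ hstab

end
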